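/- Let $n\ge 0$ be an integer. Let $B_1,\dots,B_{n+1}$ be standard one-dimensional Brownian motions and $C$ a standard symmetric Cauchy process (càdlàg, $C(0)=0$, with stationary independent increments, $C(t)$ having density $\frac{t}{\pi(t^2+x^2)}$), all mutually independent, and let $I_n(t)=B_1(|B_2(\cdots|B_{n+1}(t)|\cdots)|)$ be the $n$-times iterated Brownian motion. Define, for $t>0$, $$p(x,t)=\frac{2}{\pi}\int_0^{\infty}\frac{s}{s^2+x^2}\,p_n(s,t)\,ds,$$ $$p_n(x,t)=2^n\int_0^\infty\!\!\cdots\!\int_0^\infty \frac{e^{-x^2/(2w_1)}}{\sqrt{2\pi w_1}}\,\frac{e^{-w_1^2/(2w_2)}}{\sqrt{2\pi w_2}}\cdots\frac{e^{-w_n^2/(2t)}}{\sqrt{2\pi t}}\,dw_n\cdots dw_1 ,$$ where $p_0(x,t)=e^{-x^2/(2t)}/\sqrt{2\pi t}$. Then: 1. for every $t>0$ the random variable $C(|I_n(t)|)$ has density $p(\cdot,t)$; 2. for all $x\neq 0$ and $t>0$, $p(\cdot,t)$ is twice continuously differentiable near $x$, the fractional derivative below exists, and $$\frac{\partial^{1/2^n}p}{\partial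 t^{1/2^n}}=-2^{\frac1{2^n}-2}\,\frac{\partial^2p}{\partial x^2}+\frac{2^{\,n-1+\frac1{2^{n+1}}}}{\pi^{3/2}}\,\frac{\Gamma(-\frac12)}{\Gamma(-\frac1{2^{n+1}})}\,\frac{t^{-1/2^{n+1}}}{x^2};$$ 3. $p(x,0)=\delta(x)$, that is, $p(\cdot,t)$ is integrable for $t>0$, $\int_{\mathbb R}\varphi(x)p(x,t)\,dx\to\varphi(0)$ as $t\downarrow 0$ for every bounded continuous $\varphi:\mathbb R\to\mathbb R$, and $p(x,t)\to 0$ as $t\downarrow0$ for every $x\ne0$. Here, for $0<\alpha<1$, $\frac{\partial^\alpha f}{\partial t^\alpha}(t)=\frac{1}{\Gamma(1-\alpha)}\int_0^t\frac{f'(s)}{(t-s)^\alpha}\,ds$ (an absolutely convergent integral) is the Caputo derivative, and $\frac{\partial^1 f}{\partial t^1}=f'$. -/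

import Mathlib

open MeasureTheory ProbabilityTheory Filter Topology
open scoped NNReal BoundedContinuousFunction

/-- A standard one-dimensional (symmetric) Cauchy process: a process starting from `0` with
stationary independent increments, the increment over `[s, t]` having the centred Cauchy law of
scale `t - s`, and with almost surely right-continuous paths having left limits. -/
structure IsCauchyMotion {Ω : Type*} [MeasurableSpace Ω] (X : ℝ≥0 → Ω → ℝ) (P : Measure Ω) :
    Prop where
  eval_zero : ∀ᵐ ω ∂P, X 0 ω = 0
  indep : HasIndepIncrements X P
  hasLaw_sub : ∀ s t : ℝ≥0, s ≤ t → HasLaw (X t - X s) (cauchyMeasure 0 (t - s)) P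
  cadlag : ∀ᵐ ω ∂P, ∀ t : ℝ≥0, Tendsto (X · ω) (𝓝[>] t) (𝓝 (X t ω)) ∧
    ∃ l : ℝ, Tendsto (X · ω) (𝓝[<] t) (𝓝 l)

/-- The `n`-times iterated process `I_n(t) = B₁(|B₂(⋯|Bₙ₊₁(t)|⋯)|)`; here `B i` stands for the
process with index `i + 1`. -/
def iteratedMotion {Ω : Type*} : (n : ℕ) → (Fin (n + 1) → ℝ≥0 → Ω → ℝ) → ℝ≥0 → Ω → ℝ
  | 0, B, t, ω => B 0 t ω
  | n + 1, B, t, ω => B 0 ‖iteratedMotion n (fun i => B i.succ) t ω‖₊ ω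

/-- The centred Gaussian density of variance `t`, i.e. `exp (-x² / (2 t)) / √(2 π t)`. -/
noncomputable def heatKernel (x t : ℝ) : ℝ :=
  Real.exp (-x ^ 2 / (2 * t)) / Real.sqrt (2 * Real.pi * t)

/-- The iterated integral
`∫₀^∞ ⋯ ∫₀^∞ g(x, w₁) g(w₁, w₂) ⋯ g(wₙ, t) dwₙ ⋯ dw₁`, where `g` is the Gaussian density. -/
noncomputable def iteratedHeatIntegral : ℕ → ℝ → ℝ → ℝ
  | 0, x, t => heatKernel x t
  | n + 1, x, t => ∫ w in Set.Ioi (0 : ℝ), heatKernel x w * iteratedHeatIntegral n w t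

/-- The density `pₙ(x, t)` of the `n`-times iterated Brownian motion. -/
noncomputable def iteratedBrownianDensity (n : ℕ) (x t : ℝ) : ℝ :=
  2 ^ n * iteratedHeatIntegral n x t

/-- The density `(2 / π) ∫₀^∞ s / (s² + x²) pₙ(s, t) ds` of `C(|I_n(t)|)`. -/
noncomputable def cauchyIteratedDensity (n : ℕ) (x t : ℝ) : ℝ :=
  2 / Real.pi * ∫ s in Set.Ioi (0 : ℝ), s / (s ^ 2 + x ^ 2) * iteratedBrownianDensity n s t

/-- `f : (0, ∞) → ℝ` has at time `t > 0` a (Caputo) fractional derivative of order `α ∈ (0, 1]`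
based at `0`, with value `d`. For `α < 1` this is
`1 / Γ(1 - α) ∫₀ᵗ f'(s) / (t - s)^α ds = d`, the integral being absolutely convergent; for `α = 1`
it is the ordinary derivative. -/
def HasCaputoDerivAt (α : ℝ) (f : ℝ → ℝ) (d t : ℝ) : Prop :=
  (α = 1 ∧ HasDerivAt f d t) ∨
  (0 < α ∧ α < 1 ∧ (∀ s ∈ Set.Ioo 0 t, DifferentiableAt ℝ f s) ∧
    IntegrableOn (fun s => deriv f s / (t - s) ^ α) (Set.Ioo 0 t) ∧
    1 / Real.Gamma (1 - α) * ∫ s in Set.Ioo 0 t, deriv f s / (t - s) ^ α = d)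

/-- The initial condition `p(x, 0) = δ(x)`: the measures `p(x, t) dx` converge weakly to the unit
mass at `0` as `t ↓ 0`. -/
def HasDiracInitialValue (p : ℝ → ℝ → ℝ) : Prop :=
  (∀ t : ℝ, 0 < t → Integrable (fun x => p x t)) ∧
  ∀ φ : ℝ →ᵇ ℝ, Tendsto (fun t => ∫ x, φ x * p x t) (𝓝[>] 0) (𝓝 (φ 0))

/-! Let `A f (t) = E f(|B(t)|)` (`brownianAverage`) and `k_x(s) = s / (s² + x²)` (`cauchyKernel`).
Integrating out the Brownian motions one at a time gives `p(x, t) = π⁻¹ A^[n+1] k_x (t)` for `x ≠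
0`, so everything reduces to properties of the single operator `A`.

The equation is proved by induction on `n`. For one average, the heat equation turns `∂/∂t` into
half of `∂²/∂s²` acting on `k_x`, with a boundary term at `s = 0`; since `k_x(s)` is harmonic in
`(x, s)`, `∂²/∂s²` is `-∂²/∂x²` (`hasDerivAt_brownianAverage_cauchyKernel`). Each further average
halves the order of the Caputo derivative: `D^(γ/2) (A F) = 2^(-γ/2) A (D^γ F)`
(`hasCaputoDerivAt_brownianAverage`). The reason is that `(A F)'(s)` is the integral of `F'(v)`
against the first-passage density `(v / s) g(v, s)`, where `g` is the heat kernel, and convolving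
this density in time with `g(y, ·)` gives `g(v + y, ·)` (`heatKernel_first_passage`). As `(t -
s)^(-γ/2)` is a multiple of `∫ g(y, t - s) y^(-γ) dy`, the fractional integral in time becomes an
average of a fractional integral in space. The boundary term is a power of `t`, which `A` maps to a
power of half the exponent times a Gaussian moment; Legendre duplication (`gaussianAbsMoment_neg`)
collects the constants.

For the law, right-continuous paths are measurable functionals of their dyadic values, so an
independent random time can be integrated out by Fubini
(`IsRightContinuousMotion.integral_comp_time`). The initial condition holds because `A` preserves
one-sided limits at `0`. -/

/-! ### The heat kernel. -/

lemma heatKernel_nonneg (x t : ℝ) : 0 ≤ heatKernel x t := by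
  unfold heatKernel; positivity

lemma measurable_heatKernel : Measurable fun p : ℝ × ℝ => heatKernel p.1 p.2 := by
  unfold heatKernel; fun_prop

@[fun_prop] lemma Measurable.heatKernel {α : Type*} [MeasurableSpace α] {f g : α → ℝ}
    (hf : Measurable f) (hg : Measurable g) : Measurable fun a => heatKernel (f a) (g a) := by
  unfold _root_.heatKernel; fun_prop

lemma continuous_heatKernel_left (t : ℝ) : Continuous fun x => heatKernel x t := by
  unfold heatKernel; fun_prop

lemma heatKernel_eq_gaussianPDFReal (x t : ℝ) (ht : 0 ≤ t) :
    heatKernel x t = gaussianPDFReal 0 t.toNNReal x := by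
  simp only [heatKernel, gaussianPDFReal_def, sub_zero, Real.coe_toNNReal _ ht, mul_assoc]
  rw [div_eq_mul_inv, mul_comm]

lemma integrable_heatKernel (t : ℝ) (ht : 0 ≤ t) : Integrable fun x => heatKernel x t := by
  simp only [heatKernel_eq_gaussianPDFReal _ _ ht]
  exact integrable_gaussianPDFReal _ _

/-! ### The Brownian averaging operator and its iterates. -/

/-- The average `E f(|B(t)|)` of a function over the modulus of a Brownian motion at time `t`. -/
noncomputable def brownianAverage (f : ℝ → ℝ) (t : ℝ) : ℝ :=
  ∫ y, f (√t * |y|) ∂gaussianReal 0 1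

lemma heatKernel_sqrt_mul (y : ℝ) {t : ℝ} (ht : 0 < t) :
    heatKernel (√t * y) t = (√t)⁻¹ * heatKernel y 1 := by
  have h : √t ≠ 0 := by positivity
  have h2 : √t ^ 2 = t := Real.sq_sqrt ht.le
  unfold heatKernel
  rw [Real.sqrt_mul (by positivity : (0 : ℝ) ≤ 2 * Real.pi), mul_pow, h2,
    show -(t * y ^ 2) / (2 * t) = -y ^ 2 / (2 * 1) by field_simp]
  simp only [mul_one]
  field_simp

/-- The average over `|B(t)|` is the integral against twice the heat kernel on the half line. -/
lemma brownianAverage_eq (f : ℝ → ℝ) {t : ℝ} (ht : 0 < t) :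
    brownianAverage f t = 2 * ∫ w in Set.Ioi 0, heatKernel w t * f w := by
  have hs : 0 < √t := Real.sqrt_pos.2 ht
  have h1 : brownianAverage f t = ∫ y, heatKernel |y| 1 * f (√t * |y|) := by
    rw [brownianAverage, integral_gaussianReal_eq_integral_smul one_ne_zero]
    congr 1 with y
    rw [heatKernel_eq_gaussianPDFReal _ _ zero_le_one]
    simp [gaussianPDFReal_def]
  rw [h1, integral_comp_abs (f := fun y => heatKernel y 1 * f (√t * y))]
  have h2 := MeasureTheory.integral_comp_mul_left_Ioi
    (fun w => √t * (heatKernel w t * f w)) 0 hs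
  simp only [mul_zero, smul_eq_mul, integral_const_mul] at h2
  rw [← mul_assoc, inv_mul_cancel₀ hs.ne', one_mul, ← integral_const_mul] at h2
  rw [← h2]
  congr 2 with y
  rw [heatKernel_sqrt_mul _ ht]
  field_simp

lemma brownianAverage_eq_integral_gaussianReal {f : ℝ → ℝ} (hf : Measurable f) (t : ℝ≥0) :
    brownianAverage f t = ∫ y, f |y| ∂gaussianReal 0 t := by
  have h := gaussianReal_map_const_mul (μ := 0) (v := 1) (√(t : ℝ))
  have h2 : NNReal.mk (√(t : ℝ) ^ 2) (sq_nonneg _) * 1 = t := by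
    ext; simp
  rw [mul_zero, h2] at h
  have hm : Measurable fun y => f |y| := hf.comp (by fun_prop)
  rw [← h, integral_map (by fun_prop) hm.aestronglyMeasurable, brownianAverage]
  simp [abs_mul, abs_of_nonneg (Real.sqrt_nonneg _)]

@[simp] lemma brownianAverage_const (c t : ℝ) : brownianAverage (fun _ => c) t = c := by
  simp [brownianAverage]

lemma integral_heatKernel_Ioi {t : ℝ} (ht : 0 < t) :
    ∫ w in Set.Ioi 0, heatKernel w t = 1 / 2 := by
  have := brownianAverage_eq (fun _ => 1) ht
  simp only [brownianAverage_const, mul_one] at this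
  linarith

@[fun_prop] lemma measurable_brownianAverage {f : ℝ → ℝ} (hf : Measurable f) :
    Measurable (brownianAverage f) := by
  have : StronglyMeasurable fun p : ℝ × ℝ => f (√p.1 * |p.2|) :=
    Measurable.stronglyMeasurable (by fun_prop)
  exact this.integral_prod_right.measurable

lemma integrable_comp_sqrt_mul_abs {f : ℝ → ℝ} (hf : Measurable f) {C : ℝ} (hC : ∀ w, |f w| ≤ C)
    (t : ℝ) : Integrable (fun y => f (√t * |y|)) (gaussianReal 0 1) :=
  Integrable.of_bound (hf.comp (by fun_prop)).aestronglyMeasurable C (ae_of_all _ fun y => hC _)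

lemma abs_brownianAverage_le {f : ℝ → ℝ} {C : ℝ} (hC : ∀ w, |f w| ≤ C) (t : ℝ) :
    |brownianAverage f t| ≤ C := by
  have := norm_integral_le_of_norm_le_const (μ := gaussianReal 0 1)
    (f := fun y => f (√t * |y|)) (ae_of_all _ fun y => hC _)
  simpa [brownianAverage] using this

/-- Dominated convergence on a Gaussian space that does not depend on `t`. The point `y = 0` must be
discarded, since there `√t * |y|` does not approach `0` from the right. -/
lemma tendsto_brownianAverage {f : ℝ → ℝ} (hf : Measurable f) {C L : ℝ} (hC : ∀ w, |f w| ≤ C)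
    (hL : Tendsto f (𝓝[>] 0) (𝓝 L)) : Tendsto (brownianAverage f) (𝓝[>] 0) (𝓝 L) := by
  have key : Tendsto (brownianAverage f) (𝓝[>] 0) (𝓝 (∫ _, L ∂gaussianReal 0 1)) := by
    refine tendsto_integral_filter_of_dominated_convergence (fun _ => C)
      (Eventually.of_forall fun t => (hf.comp (by fun_prop)).aestronglyMeasurable)
      (Eventually.of_forall fun t => ae_of_all _ fun y => hC _) (integrable_const _) ?_
    have h0 : ∀ᵐ y ∂gaussianReal 0 1, y ≠ 0 := by
      have := nullSingletonClass_gaussianReal (μ := 0) (v := 1) one_ne_zero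
      simp [ae_iff]
    filter_upwards [h0] with y hy
    refine hL.comp (tendsto_nhdsWithin_iff.2 ⟨?_, ?_⟩)
    · have : Continuous fun t : ℝ => √t * |y| := by fun_prop
      simpa using (this.tendsto 0).mono_left nhdsWithin_le_nhds
    · filter_upwards [self_mem_nhdsWithin] with t ht
      have := Real.sqrt_pos.2 ht
      have := abs_pos.2 hy
      exact Set.mem_Ioi.2 (by positivity)
  simpa using key

section Iterate

variable {f : ℝ → ℝ} {C : ℝ}

lemma measurable_iterate_brownianAverage (hf : Measurable f) (n : ℕ) :
    Measurable (brownianAverage^[n] f) := by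
  induction n generalizing f with
  | zero => exact hf
  | succ n ih => exact ih (by fun_prop)

lemma abs_iterate_brownianAverage_le (hC : ∀ w, |f w| ≤ C) (n : ℕ) (t : ℝ) :
    |brownianAverage^[n] f t| ≤ C := by
  induction n generalizing f with
  | zero => exact hC t
  | succ n ih => exact ih (abs_brownianAverage_le hC)

lemma tendsto_iterate_brownianAverage {L : ℝ} (hf : Measurable f) (hC : ∀ w, |f w| ≤ C)
    (hL : Tendsto f (𝓝[>] 0) (𝓝 L)) (n : ℕ) :
    Tendsto (brownianAverage^[n] f) (𝓝[>] 0) (𝓝 L) := by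
  induction n generalizing f with
  | zero => exact hL
  | succ n ih =>
    exact ih (by fun_prop) (abs_brownianAverage_le hC) (tendsto_brownianAverage hf hC hL)

end Iterate

/-! ### The iterated heat integral as repeated averaging. -/

lemma iteratedHeatIntegral_nonneg (n : ℕ) (x t : ℝ) : 0 ≤ iteratedHeatIntegral n x t := by
  induction n generalizing x with
  | zero => exact heatKernel_nonneg x t
  | succ n ih => exact integral_nonneg fun w => mul_nonneg (heatKernel_nonneg _ _) (ih w)

lemma measurable_iteratedHeatIntegral (n : ℕ) (t : ℝ) :
    Measurable fun x => iteratedHeatIntegral n x t := by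
  induction n with
  | zero => exact (continuous_heatKernel_left t).measurable
  | succ n ih =>
    have : StronglyMeasurable fun p : ℝ × ℝ => heatKernel p.1 p.2 * iteratedHeatIntegral n p.2 t :=
      (measurable_heatKernel.mul (ih.comp measurable_snd)).stronglyMeasurable
    exact this.integral_prod_right.measurable

/-- By Tonelli: the heat kernel has mass `1 / 2` over the half line in its space variable, whatever
its variance `w > 0`, so only the integrability of `g` matters. -/
lemma integrable_heatKernel_mul_prod {g : ℝ → ℝ} (hg : IntegrableOn g (Set.Ioi 0))
    (hgm : Measurable g) :
    Integrable (fun p : ℝ × ℝ => heatKernel p.1 p.2 * g p.2)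
      ((volume.restrict (Set.Ioi 0)).prod (volume.restrict (Set.Ioi 0))) := by
  have hm : Measurable fun p : ℝ × ℝ => heatKernel p.1 p.2 * g p.2 :=
    measurable_heatKernel.mul (hgm.comp measurable_snd)
  rw [integrable_prod_iff' hm.aestronglyMeasurable]
  constructor
  · filter_upwards [ae_restrict_mem measurableSet_Ioi] with w hw
    exact ((integrable_heatKernel w (le_of_lt hw)).integrableOn).mul_const _
  · refine Integrable.congr (hg.norm.const_mul (1 / 2)) ?_
    filter_upwards [ae_restrict_mem measurableSet_Ioi] with w hw
    simp only [norm_mul, Real.norm_eq_abs, abs_of_nonneg (heatKernel_nonneg _ _)]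
    rw [integral_mul_const, integral_heatKernel_Ioi hw]

lemma integrableOn_iteratedHeatIntegral (n : ℕ) {t : ℝ} (ht : 0 < t) :
    IntegrableOn (fun x => iteratedHeatIntegral n x t) (Set.Ioi 0) := by
  induction n with
  | zero => exact (integrable_heatKernel t ht.le).integrableOn
  | succ n ih =>
    exact (integrable_heatKernel_mul_prod ih (measurable_iteratedHeatIntegral n t)).integral_prod_left

/-- Averaging a function over `|I_n(t)|` amounts to averaging over the Brownian motions one by
one. -/
lemma integral_mul_iteratedHeatIntegral {f : ℝ → ℝ} (hf : Measurable f) {C : ℝ}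
    (hC : ∀ w, |f w| ≤ C) (n : ℕ) {t : ℝ} (ht : 0 < t) :
    2 ^ (n + 1) * ∫ s in Set.Ioi 0, f s * iteratedHeatIntegral n s t =
      brownianAverage^[n + 1] f t := by
  induction n generalizing f with
  | zero =>
    simp only [iteratedHeatIntegral, zero_add, pow_one, Function.iterate_one]
    rw [brownianAverage_eq f ht]
    simp only [mul_comm]
  | succ n ih =>
    rw [Function.iterate_succ_apply, ← ih (by fun_prop) (abs_brownianAverage_le hC), pow_succ _ (n + 1),
      mul_assoc]
    congr 1
    simp only [iteratedHeatIntegral, ← integral_const_mul]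
    have hint : Integrable (Function.uncurry fun s w =>
        2 * (f s * (heatKernel s w * iteratedHeatIntegral n w t)))
        ((volume.restrict (Set.Ioi 0)).prod (volume.restrict (Set.Ioi 0))) := by
      refine Integrable.const_mul ?_ 2
      exact (integrable_heatKernel_mul_prod (integrableOn_iteratedHeatIntegral n ht)
        (measurable_iteratedHeatIntegral n t)).bdd_mul (c := C)
        (hf.comp measurable_fst).aestronglyMeasurable (ae_of_all _ fun p => hC _)
    rw [integral_integral_swap hint]
    refine setIntegral_congr_fun measurableSet_Ioi fun w hw => ?_
    rw [brownianAverage_eq f hw, ← integral_const_mul, ← integral_mul_const]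
    congr 1 with s
    ring

/-! ### The first-passage identity. -/

/-- Because the derivative is nonnegative, its integrability follows from the finite endpoint
limits; `G` is extended continuously to the closed interval to obtain it. -/
lemma integral_Ioo_of_hasDerivAt_of_nonneg {G G' : ℝ → ℝ} {a b la lb : ℝ} (hab : a < b)
    (hderiv : ∀ x ∈ Set.Ioo a b, HasDerivAt G (G' x) x) (hpos : ∀ x ∈ Set.Ioo a b, 0 ≤ G' x)
    (ha : Tendsto G (𝓝[>] a) (𝓝 la)) (hb : Tendsto G (𝓝[<] b) (𝓝 lb)) :
    IntegrableOn G' (Set.Ioo a b) ∧ ∫ x in Set.Ioo a b, G' x = lb - la := by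
  have hcont : ContinuousOn G (Set.Ioo a b) := fun x hx =>
    (hderiv x hx).continuousAt.continuousWithinAt
  have hext : ∀ x ∈ Set.Ioo a b, HasDerivAt (extendFrom (Set.Ioo a b) G) (G' x) x := by
    intro x hx
    refine (hderiv x hx).congr_of_eventuallyEq ?_
    filter_upwards [Ioo_mem_nhds hx.1 hx.2] with y hy using extendFrom_extends hcont y hy
  have hint := intervalIntegral.integrableOn_deriv_of_nonneg
    (continuousOn_Icc_extendFrom_Ioo hcont ha hb) hext hpos
  refine ⟨hint.mono_set Set.Ioo_subset_Ioc_self, ?_⟩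
  rw [← integral_Ioc_eq_integral_Ioo, ← intervalIntegral.integral_of_le hab.le]
  exact intervalIntegral.integral_eq_sub_of_hasDerivAt_of_tendsto hab hderiv
    ((intervalIntegrable_iff_integrableOn_Ioc_of_le hab.le).2 hint) ha hb

lemma heatKernel_neg (x t : ℝ) : heatKernel (-x) t = heatKernel x t := by
  simp [heatKernel]

lemma integral_heatKernel_tendsto_atTop {t : ℝ} (ht : 0 < t) :
    Tendsto (fun y => ∫ z in (0 : ℝ)..y, heatKernel z t) atTop (𝓝 (1 / 2)) := by
  rw [← integral_heatKernel_Ioi ht]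
  exact intervalIntegral_tendsto_integral_Ioi 0 (integrable_heatKernel t ht.le).integrableOn
    tendsto_id

lemma integral_heatKernel_tendsto_atBot {t : ℝ} (ht : 0 < t) :
    Tendsto (fun y => ∫ z in (0 : ℝ)..y, heatKernel z t) atBot (𝓝 (-(1 / 2))) := by
  have h := (integral_heatKernel_tendsto_atTop ht).comp tendsto_neg_atBot_atTop
  refine h.neg.congr fun y => ?_
  have := intervalIntegral.integral_comp_neg (a := 0) (b := y) (fun z => heatKernel z t)
  simp only [heatKernel_neg, neg_zero] at this
  rw [Function.comp_apply, this, ← intervalIntegral.integral_symm]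

/-- Completing the square: with `v = √((t - s) / s)`, one has `a² / s + b² / (t - s) = ((a + b)² +
(a v - b / v)²) / t`. -/
lemma heatKernel_mul_heatKernel_eq {a b s t : ℝ} (hs : 0 < s) (hst : s < t) :
    heatKernel a s * heatKernel b (t - s) = t / (s * √((t - s) / s)) *
      (heatKernel (a + b) t * heatKernel (a * √((t - s) / s) - b * (√((t - s) / s))⁻¹) t) := by
  have hu : 0 < t - s := sub_pos.2 hst
  have ht : 0 < t := hs.trans hst
  set v := √((t - s) / s) with hv
  have hv0 : 0 < v := Real.sqrt_pos.2 (by positivity)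
  have hv2 : v ^ 2 = (t - s) / s := Real.sq_sqrt (by positivity)
  have hsv : √s * √(t - s) = s * v := by
    rw [hv, Real.sqrt_div hu.le]
    have := Real.sqrt_pos.2 hs
    field_simp
    rw [Real.sq_sqrt hs.le]
  have hp : (a * v - b * v⁻¹) ^ 2 = a ^ 2 * ((t - s) / s) - 2 * a * b + b ^ 2 * (s / (t - s)) := by
    have : v⁻¹ ^ 2 = s / (t - s) := by rw [inv_pow, hv2, inv_div]
    rw [← this, ← hv2]
    field_simp
    ring
  have hexp : Real.exp (-a ^ 2 / (2 * s)) * Real.exp (-b ^ 2 / (2 * (t - s))) =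
      Real.exp (-(a + b) ^ 2 / (2 * t)) * Real.exp (-(a * v - b * v⁻¹) ^ 2 / (2 * t)) := by
    rw [← Real.exp_add, ← Real.exp_add, hp]
    congr 1
    field_simp
    ring
  have hpi : (0 : ℝ) ≤ 2 * Real.pi := by positivity
  simp only [heatKernel]
  rw [div_mul_div_comm, div_mul_div_comm, ← hexp, Real.sqrt_mul hpi, Real.sqrt_mul hpi,
    show √(2 * Real.pi) * √s * (√(2 * Real.pi) * √(t - s)) =
      (√(2 * Real.pi) * √(2 * Real.pi)) * (√s * √(t - s)) by ring, hsv,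
    Real.mul_self_sqrt hpi, Real.mul_self_sqrt (by positivity)]
  field_simp

/-- Decomposition of the heat kernel at the first passage of `a` by a Brownian motion on its way
to `a + b`. -/
lemma heatKernel_first_passage {a b t : ℝ} (ha : 0 < a) (hb : 0 ≤ b) (ht : 0 < t) :
    IntegrableOn (fun s => a / s * heatKernel a s * heatKernel b (t - s)) (Set.Ioo 0 t) ∧
      ∫ s in Set.Ioo 0 t, a / s * heatKernel a s * heatKernel b (t - s) =
        heatKernel (a + b) t := by
  set v : ℝ → ℝ := fun s => √((t - s) / s) with hv
  set Ψ : ℝ → ℝ := fun y => ∫ z in (0 : ℝ)..y, heatKernel z t with hΨ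
  have hΨd : ∀ y, HasDerivAt Ψ (heatKernel y t) y := fun y =>
    ((continuous_heatKernel_left t).integral_hasStrictDerivAt 0 y).hasDerivAt
  -- An explicit antiderivative. The arguments `a v ∓ b / v` have derivatives `v' (a ± b / v²)`; the
  -- two Gaussian weights turn out equal, so the `b` parts cancel and `2 a v'` remains.
  set G : ℝ → ℝ := fun s => -(heatKernel (a + b) t * Ψ (a * v s - b * (v s)⁻¹) +
    heatKernel (a - b) t * Ψ (a * v s + b * (v s)⁻¹)) with hG
  have hvtop : Tendsto v (𝓝[>] 0) atTop := by
    refine Real.tendsto_sqrt_atTop.comp ?_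
    have h1 : Tendsto (fun s : ℝ => t - s) (𝓝[>] 0) (𝓝 t) := by
      have : Continuous fun s : ℝ => t - s := by fun_prop
      simpa using (this.tendsto 0).mono_left nhdsWithin_le_nhds
    exact (h1.pos_mul_atTop ht tendsto_inv_nhdsGT_zero).congr fun s => (div_eq_mul_inv _ _).symm
  have hvzero : Tendsto v (𝓝[<] t) (𝓝[>] 0) := by
    refine tendsto_nhdsWithin_iff.2 ⟨?_, ?_⟩
    · have : ContinuousAt v t := by
        refine Real.continuous_sqrt.continuousAt.comp ?_
        exact (by fun_prop : ContinuousAt (fun s : ℝ => t - s) t).div continuousAt_id ht.ne'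
      simpa [hv] using this.tendsto.mono_left nhdsWithin_le_nhds
    · filter_upwards [Ioo_mem_nhdsLT ht] with s hs
      exact Real.sqrt_pos.2 (div_pos (sub_pos.2 hs.2) hs.1)
  have hderiv : ∀ s ∈ Set.Ioo 0 t,
      HasDerivAt G (a / s * heatKernel a s * heatKernel b (t - s)) s := by
    intro s ⟨hs, hst⟩
    have hu : 0 < t - s := sub_pos.2 hst
    have hv0 : 0 < v s := Real.sqrt_pos.2 (by positivity)
    have hr : HasDerivAt (fun s => (t - s) / s) (-t / s ^ 2) s := by
      convert! ((hasDerivAt_id s).const_sub t).div (hasDerivAt_id s) hs.ne' using 1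
      simp only [id_eq]
      ring
    have hvd : HasDerivAt v (-t / s ^ 2 / (2 * v s)) s := hr.sqrt (by positivity)
    have hid : HasDerivAt (fun s => (v s)⁻¹) (-(-t / s ^ 2 / (2 * v s)) / v s ^ 2) s :=
      hvd.inv hv0.ne'
    have hp := (hΨd _).comp s ((hvd.const_mul a).sub (hid.const_mul b))
    have hq := (hΨd _).comp s ((hvd.const_mul a).add (hid.const_mul b))
    have hGd := ((hp.const_mul (heatKernel (a + b) t)).add
      (hq.const_mul (heatKernel (a - b) t))).neg
    refine hGd.congr_deriv ?_
    -- The exponents agree since `(a - b)² + (a v + b / v)² = (a + b)² + (a v - b / v)²`.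
    have hH : heatKernel (a - b) t * heatKernel (a * v s + b * (v s)⁻¹) t =
        heatKernel (a + b) t * heatKernel (a * v s - b * (v s)⁻¹) t := by
      simp only [heatKernel]
      rw [div_mul_div_comm, div_mul_div_comm, ← Real.exp_add, ← Real.exp_add]
      congr 2
      field_simp
      ring
    simp only [Pi.add_apply, Pi.sub_apply]
    rw [mul_assoc (a / s), heatKernel_mul_heatKernel_eq hs hst]
    change _ = a / s * (t / (s * v s) *
      (heatKernel (a + b) t * heatKernel (a * v s - b * (v s)⁻¹) t))
    rw [← mul_assoc, ← mul_assoc, hH]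
    field_simp
    ring
  have hzero : Tendsto G (𝓝[>] 0) (𝓝 (-(heatKernel (a + b) t * (1 / 2) +
      heatKernel (a - b) t * (1 / 2)))) := by
    have hi : Tendsto (fun s => b * (v s)⁻¹) (𝓝[>] 0) (𝓝 0) := by
      simpa using (tendsto_inv_atTop_zero.comp hvtop).const_mul b
    have ha' : Tendsto (fun s => a * v s) (𝓝[>] 0) atTop := hvtop.const_mul_atTop ha
    have h1 : Tendsto (fun s => a * v s - b * (v s)⁻¹) (𝓝[>] 0) atTop := by
      simpa only [sub_eq_add_neg] using ha'.atTop_add hi.neg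
    have h2 : Tendsto (fun s => a * v s + b * (v s)⁻¹) (𝓝[>] 0) atTop := ha'.atTop_add hi
    exact ((((integral_heatKernel_tendsto_atTop ht).comp h1).const_mul _).add
      (((integral_heatKernel_tendsto_atTop ht).comp h2).const_mul _)).neg
  have ht' : Tendsto G (𝓝[<] t) (𝓝 (heatKernel (a + b) t -
      (heatKernel (a + b) t * (1 / 2) + heatKernel (a - b) t * (1 / 2)))) := by
    have hv0 : Tendsto (fun s => a * v s) (𝓝[<] t) (𝓝 0) := by
      simpa using (hvzero.mono_right nhdsWithin_le_nhds).const_mul a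
    -- For `b = 0` the term `b / v` vanishes instead of blowing up as `s → t`, but `G` has the same
    -- limiting formula.
    rcases hb.eq_or_lt with rfl | hb
    · have hΨ0 : Tendsto Ψ (𝓝 0) (𝓝 0) := by
        simpa [hΨ] using (hΨd 0).continuousAt.tendsto
      have h := hΨ0.comp hv0
      have := ((h.const_mul (heatKernel a t)).add (h.const_mul (heatKernel a t))).neg
      convert! this using 2 <;> simp [hG]
      ring
    · have hi : Tendsto (fun s => b * (v s)⁻¹) (𝓝[<] t) atTop :=
        (tendsto_inv_nhdsGT_zero.comp hvzero).const_mul_atTop hb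
      have h1 : Tendsto (fun s => a * v s - b * (v s)⁻¹) (𝓝[<] t) atBot := by
        simpa only [sub_eq_add_neg, Function.comp_def] using
          hv0.add_atBot (tendsto_neg_atTop_atBot.comp hi)
      have h2 : Tendsto (fun s => a * v s + b * (v s)⁻¹) (𝓝[<] t) atTop := hv0.add_atTop hi
      have := ((((integral_heatKernel_tendsto_atBot ht).comp h1).const_mul
        (heatKernel (a + b) t)).add
        (((integral_heatKernel_tendsto_atTop ht).comp h2).const_mul (heatKernel (a - b) t))).neg
      convert! this using 2
      ring
  have := integral_Ioo_of_hasDerivAt_of_nonneg ht hderiv (fun s hs => mul_nonneg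
    (mul_nonneg (div_nonneg ha.le hs.1.le) (heatKernel_nonneg _ _)) (heatKernel_nonneg _ _))
    hzero ht'
  refine ⟨this.1, this.2.trans ?_⟩
  ring

/-! ### Gaussian moments and fractional integrals of the first-passage density. -/

/-- The absolute moment `E |N|ʳ` of a standard normal variable. -/
noncomputable def gaussianAbsMoment (r : ℝ) : ℝ :=
  2 ^ (r / 2) * Real.Gamma ((r + 1) / 2) / √Real.pi

lemma heatKernel_eq_mul_exp (w t : ℝ) :
    heatKernel w t = (√(2 * Real.pi * t))⁻¹ * Real.exp (-(1 / (2 * t)) * w ^ 2) := by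
  rw [heatKernel, div_eq_inv_mul]
  congr 2
  ring

lemma integrableOn_heatKernel_mul_rpow {r t : ℝ} (hr : -1 < r) (ht : 0 < t) :
    IntegrableOn (fun w => heatKernel w t * w ^ r) (Set.Ioi 0) := by
  have := (integrableOn_rpow_mul_exp_neg_mul_sq (b := 1 / (2 * t)) (by positivity) hr).const_mul
    (√(2 * Real.pi * t))⁻¹
  refine IntegrableOn.congr_fun this (fun w _ => ?_) measurableSet_Ioi
  simp only [heatKernel_eq_mul_exp]
  ring

lemma brownianAverage_rpow {r t : ℝ} (hr : -1 < r) (ht : 0 < t) :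
    brownianAverage (fun w => w ^ r) t = gaussianAbsMoment r * t ^ (r / 2) := by
  have h := integral_rpow_mul_exp_neg_mul_rpow (p := 2) (q := r) (b := 1 / (2 * t)) two_pos hr
    (by positivity)
  have h2 : ∫ w in Set.Ioi 0, heatKernel w t * w ^ r =
      (√(2 * Real.pi * t))⁻¹ * ∫ w in Set.Ioi 0, w ^ r * Real.exp (-(1 / (2 * t)) * w ^ (2 : ℝ)) := by
    rw [← integral_const_mul]
    congr 1 with w
    rw [heatKernel_eq_mul_exp, Real.rpow_two]
    ring
  rw [brownianAverage_eq _ ht, h2, h, gaussianAbsMoment]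
  have h3 : (1 / (2 * t)) ^ (-(r + 1) / 2) = 2 ^ (r / 2) * t ^ (r / 2) * (√2 * √t) := by
    rw [one_div, Real.inv_rpow (by positivity), ← Real.rpow_neg (by positivity),
      show -(-(r + 1) / 2) = r / 2 + 1 / 2 by ring, Real.rpow_add (by positivity),
      ← Real.sqrt_eq_rpow, Real.mul_rpow (by positivity) ht.le, Real.sqrt_mul (by positivity)]
  rw [h3, Real.sqrt_mul (by positivity), Real.sqrt_mul (by positivity)]
  field_simp

lemma gaussianAbsMoment_pos {r : ℝ} (hr : -1 < r) : 0 < gaussianAbsMoment r := by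
  have := Real.Gamma_pos_of_pos (s := (r + 1) / 2) (by linarith)
  unfold gaussianAbsMoment
  positivity

/-- Legendre's duplication formula at `(1 - γ) / 2`. It exchanges the Caputo normalisation `Γ(1 -
γ)` for `Γ(1 - γ / 2)` when the order is halved. -/
lemma gaussianAbsMoment_neg (γ : ℝ) :
    gaussianAbsMoment (-γ) * Real.Gamma (1 - γ / 2) = 2 ^ (γ / 2) * Real.Gamma (1 - γ) := by
  have h := Real.Gamma_mul_Gamma_add_half ((1 - γ) / 2)
  rw [show (1 - γ) / 2 + 1 / 2 = 1 - γ / 2 by ring, show 2 * ((1 - γ) / 2) = 1 - γ by ring,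
    show 1 - (1 - γ) = γ by ring] at h
  have h2 : (2 : ℝ) ^ (-γ / 2) * 2 ^ γ = 2 ^ (γ / 2) := by
    rw [← Real.rpow_add two_pos]; congr 1; ring
  rw [gaussianAbsMoment, show (-γ + 1) / 2 = (1 - γ) / 2 by ring, div_mul_eq_mul_div, mul_assoc, h,
    ← h2]
  field_simp

lemma heatKernel_zero_left {t : ℝ} (ht : 0 < t) :
    heatKernel 0 t = (√(2 * Real.pi))⁻¹ * t ^ (-(1 / 2) : ℝ) := by
  rw [heatKernel, Real.rpow_neg ht.le, ← Real.sqrt_eq_rpow, Real.sqrt_mul (by positivity)]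
  simp [mul_comm]

/-- From `(v + y)² ≥ v² + y²`; it separates the variables in the domination arguments. -/
lemma heatKernel_add_le {v y t : ℝ} (hv : 0 ≤ v) (hy : 0 ≤ y) (ht : 0 < t) :
    heatKernel (v + y) t ≤ heatKernel v t * √(2 * Real.pi * t) * heatKernel y t := by
  have h : 0 < √(2 * Real.pi * t) := by positivity
  simp only [heatKernel]
  rw [div_mul_cancel₀ _ h.ne', mul_div_assoc', ← Real.exp_add]
  gcongr
  rw [← add_div]
  gcongr
  nlinarith [mul_nonneg hv hy]

lemma integrableOn_heatKernel_add_mul_rpow {γ v t : ℝ} (hγ : γ < 1) (hv : 0 ≤ v) (ht : 0 < t) :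
    IntegrableOn (fun y => heatKernel (v + y) t * y ^ (-γ)) (Set.Ioi 0) := by
  have h := (integrableOn_heatKernel_mul_rpow (r := -γ) (by linarith) ht).const_mul
    (heatKernel v t * √(2 * Real.pi * t))
  refine Integrable.mono' h ?_ ?_
  · exact Measurable.aestronglyMeasurable
      (((continuous_heatKernel_left t).measurable.comp (by fun_prop)).mul (by fun_prop))
  · filter_upwards [ae_restrict_mem measurableSet_Ioi] with y hy
    have hy' : 0 ≤ y := le_of_lt hy
    rw [Real.norm_of_nonneg (mul_nonneg (heatKernel_nonneg _ _) (Real.rpow_nonneg hy' _)),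
      ← mul_assoc]
    exact mul_le_mul_of_nonneg_right (heatKernel_add_le hv hy' ht) (Real.rpow_nonneg hy' _)

lemma first_passage_nonneg {v s : ℝ} (hv : 0 ≤ v) (hs : 0 ≤ s) (c t : ℝ) (hst : s ≤ t) :
    0 ≤ v / s * heatKernel v s * (t - s) ^ c :=
  mul_nonneg (mul_nonneg (div_nonneg hv hs) (heatKernel_nonneg _ _))
    (Real.rpow_nonneg (sub_nonneg.2 hst) _)

/-- The factor `(t - s)^(-γ / 2)` is a Gaussian moment, an integral of `heatKernel y (t - s) * y ^
(-γ)` over `y`. After Fubini the `s`-integral is the first-passage identity. Integrability of `y ^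
(-γ)` at `0` requires `γ < 1`. -/
lemma integral_first_passage_mul_rpow {γ v t : ℝ} (hγ : γ < 1) (hv : 0 < v) (ht : 0 < t) :
    IntegrableOn (fun s => v / s * heatKernel v s * (t - s) ^ (-γ / 2)) (Set.Ioo 0 t) ∧
      gaussianAbsMoment (-γ) / 2 * ∫ s in Set.Ioo 0 t, v / s * heatKernel v s * (t - s) ^ (-γ / 2) =
        ∫ y in Set.Ioi 0, heatKernel (v + y) t * y ^ (-γ) := by
  set h : ℝ → ℝ → ℝ := fun s y => v / s * heatKernel v s * heatKernel y (t - s) * y ^ (-γ) with hh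
  have hm : Measurable (Function.uncurry h) := by
    simp only [hh, Function.uncurry_def]
    fun_prop
  have hint : Integrable (Function.uncurry h)
      ((volume.restrict (Set.Ioo 0 t)).prod (volume.restrict (Set.Ioi 0))) := by
    rw [integrable_prod_iff' hm.aestronglyMeasurable]
    constructor
    · filter_upwards [ae_restrict_mem measurableSet_Ioi] with y hy
      have h1 := Integrable.mul_const (heatKernel_first_passage hv (le_of_lt hy) ht).1 (y ^ (-γ))
      exact h1
    · refine Integrable.congr (integrableOn_heatKernel_add_mul_rpow hγ hv.le ht) ?_
      filter_upwards [ae_restrict_mem measurableSet_Ioi] with y hy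
      have hy' : 0 ≤ y := le_of_lt hy
      rw [← (heatKernel_first_passage hv hy' ht).2, ← integral_mul_const]
      refine setIntegral_congr_fun measurableSet_Ioo fun s hs => ?_
      exact (Real.norm_of_nonneg (mul_nonneg (mul_nonneg (mul_nonneg
        (div_nonneg hv.le hs.1.le) (heatKernel_nonneg _ _)) (heatKernel_nonneg _ _))
        (Real.rpow_nonneg hy' _))).symm
  have hK := gaussianAbsMoment_pos (r := -γ) (by linarith)
  have hinner : ∀ s ∈ Set.Ioo 0 t, ∫ y in Set.Ioi 0, h s y =
      gaussianAbsMoment (-γ) / 2 * (v / s * heatKernel v s * (t - s) ^ (-γ / 2)) := by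
    intro s hs
    have h1 := brownianAverage_rpow (r := -γ) (t := t - s) (by linarith) (sub_pos.2 hs.2)
    rw [brownianAverage_eq _ (sub_pos.2 hs.2)] at h1
    have h2 : ∫ y in Set.Ioi 0, h s y = v / s * heatKernel v s *
        ∫ y in Set.Ioi 0, heatKernel y (t - s) * y ^ (-γ) := by
      rw [← integral_const_mul]
      simp only [hh, mul_assoc]
    rw [h2]
    linear_combination (v / s * heatKernel v s / 2) * h1
  constructor
  · have h1 : IntegrableOn (fun s => (gaussianAbsMoment (-γ) / 2)⁻¹ * ∫ y in Set.Ioi 0, h s y)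
      (Set.Ioo 0 t) := hint.integral_prod_left.const_mul _
    refine IntegrableOn.congr_fun h1 (fun s hs => ?_) measurableSet_Ioo
    simp only [hinner s hs]
    field_simp
  · rw [← integral_const_mul, ← setIntegral_congr_fun measurableSet_Ioo hinner,
      integral_integral_swap hint]
    refine setIntegral_congr_fun measurableSet_Ioi fun y hy => ?_
    rw [← (heatKernel_first_passage hv (le_of_lt hy) ht).2, ← integral_mul_const]

/-- The endpoint `γ = 1`, where `1 / y` is not integrable at `0`. Here `(t - s)^(-1/2)` is itself a
multiple of `heatKernel 0 (t - s)`, and the first-passage identity applies with `b = 0`. -/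
lemma integral_first_passage_mul_rpow_half {v t : ℝ} (hv : 0 < v) (ht : 0 < t) :
    IntegrableOn (fun s => v / s * heatKernel v s * (t - s) ^ (-1 / 2 : ℝ)) (Set.Ioo 0 t) ∧
      ∫ s in Set.Ioo 0 t, v / s * heatKernel v s * (t - s) ^ (-1 / 2 : ℝ) =
        √(2 * Real.pi) * heatKernel v t := by
  have h := heatKernel_first_passage hv le_rfl ht
  have heq : ∀ s ∈ Set.Ioo 0 t, √(2 * Real.pi) * (v / s * heatKernel v s * heatKernel 0 (t - s)) =
      v / s * heatKernel v s * (t - s) ^ (-1 / 2 : ℝ) := by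
    intro s hs
    rw [heatKernel_zero_left (sub_pos.2 hs.2), neg_div]
    have : 0 < √(2 * Real.pi) := by positivity
    field_simp
  constructor
  · have h1 : IntegrableOn (fun s => √(2 * Real.pi) *
      (v / s * heatKernel v s * heatKernel 0 (t - s))) (Set.Ioo 0 t) := h.1.const_mul _
    exact IntegrableOn.congr_fun h1 heq measurableSet_Ioo
  · rw [← setIntegral_congr_fun measurableSet_Ioo heq, integral_const_mul, h.2, add_zero]

/-- A bound uniform in `v`, covering both regimes of `γ`, that justifies the Fubini exchange against
`deriv F`. -/
lemma exists_integral_first_passage_le {γ t : ℝ} (hγ : γ ≤ 1) (ht : 0 < t) :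
    ∃ C, ∀ v, 0 < v →
      IntegrableOn (fun s => v / s * heatKernel v s * (t - s) ^ (-γ / 2)) (Set.Ioo 0 t) ∧
      ∫ s in Set.Ioo 0 t, v / s * heatKernel v s * (t - s) ^ (-γ / 2) ≤ C * heatKernel v t := by
  rcases hγ.eq_or_lt with rfl | hγ
  · exact ⟨√(2 * Real.pi), fun v hv => ⟨(integral_first_passage_mul_rpow_half hv ht).1,
      (integral_first_passage_mul_rpow_half hv ht).2.le⟩⟩
  · have hK := gaussianAbsMoment_pos (r := -γ) (by linarith)
    refine ⟨(gaussianAbsMoment (-γ) / 2)⁻¹ * (√(2 * Real.pi * t) *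
      ∫ y in Set.Ioi 0, heatKernel y t * y ^ (-γ)), fun v hv => ?_⟩
    obtain ⟨h1, h2⟩ := integral_first_passage_mul_rpow hγ hv ht
    refine ⟨h1, ?_⟩
    have h3 : ∫ y in Set.Ioi 0, heatKernel (v + y) t * y ^ (-γ) ≤
        heatKernel v t * √(2 * Real.pi * t) * ∫ y in Set.Ioi 0, heatKernel y t * y ^ (-γ) := by
      rw [← integral_const_mul]
      refine setIntegral_mono_on (integrableOn_heatKernel_add_mul_rpow hγ hv.le ht)
        ((integrableOn_heatKernel_mul_rpow (by linarith) ht).const_mul _) measurableSet_Ioi ?_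
      intro y hy
      have hy' : 0 ≤ y := le_of_lt hy
      rw [← mul_assoc]
      exact mul_le_mul_of_nonneg_right (heatKernel_add_le hv.le hy' ht) (Real.rpow_nonneg hy' _)
    rw [← h2] at h3
    rw [mul_assoc, inv_mul_eq_div, le_div_iff₀ (by positivity)]
    linarith

/-! ### Averaging halves the order of a Caputo derivative. -/

/-- Bounded functions on the half line whose derivative is `O(s ^ (κ - 1))`. -/
structure HasPowerDerivBound (κ : ℝ) (F : ℝ → ℝ) : Prop where
  measurable : Measurable F
  bounded : ∃ C, ∀ w, |F w| ≤ C
  differentiableAt : ∀ s, 0 < s → DifferentiableAt ℝ F s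
  deriv_le : ∃ C, ∀ s, 0 < s → |deriv F s| ≤ C * s ^ (κ - 1)

namespace HasPowerDerivBound

variable {κ : ℝ} {F : ℝ → ℝ}

/-- Differentiation under the Gaussian integral: the derivative of `F (√s * |y|)` in `s` is
`O(s^(κ/2 - 1) |y|^κ)`. -/
lemma hasDerivAt_brownianAverage (hF : HasPowerDerivBound κ F) (hκ : 0 < κ) (hκ1 : κ ≤ 1)
    {t : ℝ} (ht : 0 < t) : HasDerivAt (brownianAverage F)
      (brownianAverage (fun w => deriv F w * (w / (2 * t))) t) t := by
  obtain ⟨C, hC⟩ := hF.bounded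
  obtain ⟨D, hD⟩ := hF.deriv_le
  have hD0 : 0 ≤ D := by simpa using (abs_nonneg _).trans (hD 1 one_pos)
  have h0 : ∀ᵐ y ∂gaussianReal 0 1, y ≠ 0 := by
    have := nullSingletonClass_gaussianReal (μ := 0) (v := 1) one_ne_zero
    simp [ae_iff]
  have hmd : Measurable (deriv F) := measurable_deriv F
  have key := hasDerivAt_integral_of_dominated_loc_of_deriv_le (μ := gaussianReal 0 1)
    -- On `s > t / 2` the power `s^(κ/2 - 1)`, of negative exponent, is at most its value at `t /
    -- 2`; and `|y|^κ ≤ 1 + |y|` because `0 < κ ≤ 1`.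
    (F := fun s y => F (√s * |y|)) (x₀ := t) (s := Set.Ioi (t / 2))
    (F' := fun s y => deriv F (√s * |y|) * ((√s * |y|) / (2 * s)))
    (bound := fun y => D * ((t / 2) ^ (κ / 2 - 1)) * (1 + |y|)) (Ioi_mem_nhds (by linarith))
    (Eventually.of_forall fun s => (hF.measurable.comp (by fun_prop)).aestronglyMeasurable)
    (integrable_comp_sqrt_mul_abs hF.measurable hC t)
    ((hmd.comp (by fun_prop)).mul (by fun_prop)).aestronglyMeasurable ?_ ?_ ?_
  · exact key.2
  · filter_upwards [h0] with y hy s hs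
    have hs0 : 0 < s := lt_trans (by linarith) (Set.mem_Ioi.1 hs)
    have hy0 : 0 < |y| := abs_pos.2 hy
    have hw : 0 < √s * |y| := mul_pos (Real.sqrt_pos.2 hs0) hy0
    have h1 : |y| ^ κ ≤ 1 + |y| := by
      rcases le_total |y| 1 with h | h
      · exact (Real.rpow_le_one hy0.le h hκ.le).trans (by linarith)
      · exact (Real.rpow_le_rpow_of_exponent_le h hκ1).trans (by simp)
    have h2 : s ^ (κ / 2 - 1) ≤ (t / 2) ^ (κ / 2 - 1) :=
      Real.rpow_le_rpow_of_nonpos (by linarith) (Set.mem_Ioi.1 hs).le (by linarith)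
    rw [norm_mul, Real.norm_eq_abs, Real.norm_of_nonneg (by positivity)]
    calc |deriv F (√s * |y|)| * (√s * |y| / (2 * s))
        ≤ D * (√s * |y|) ^ (κ - 1) * (√s * |y| / (2 * s)) := by
          gcongr; exact hD _ hw
      _ = D * ((√s * |y|) ^ κ / (2 * s)) := by
          rw [Real.rpow_sub_one hw.ne']; field_simp
      _ = D * (s ^ (κ / 2 - 1) * |y| ^ κ / 2) := by
          rw [Real.mul_rpow (by positivity) hy0.le, Real.sqrt_eq_rpow, ← Real.rpow_mul hs0.le,
            Real.rpow_sub_one hs0.ne', show 1 / 2 * κ = κ / 2 by ring]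
          field_simp
      _ ≤ D * (s ^ (κ / 2 - 1) * |y| ^ κ) := by
          gcongr
          exact half_le_self (by positivity)
      _ ≤ D * ((t / 2) ^ (κ / 2 - 1) * (1 + |y|)) := by gcongr
      _ = _ := by ring
  · have : Integrable (fun y : ℝ => y) (gaussianReal 0 1) :=
      (memLp_id_gaussianReal 1).integrable le_rfl
    exact ((integrable_const 1).add this.abs).const_mul _
  · filter_upwards [h0] with y hy s hs
    have hs0 : 0 < s := lt_trans (by linarith) (Set.mem_Ioi.1 hs)
    have hs1 := Real.sqrt_pos.2 hs0
    have hw : 0 < √s * |y| := mul_pos hs1 (abs_pos.2 hy)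
    have h1 : HasDerivAt (fun s => √s * |y|) (1 / (2 * √s) * |y|) s :=
      (Real.hasDerivAt_sqrt hs0.ne').mul_const _
    refine ((hF.differentiableAt _ hw).hasDerivAt.comp s h1).congr_deriv ?_
    congr 1
    nth_rw 3 [← Real.mul_self_sqrt hs0.le]
    field_simp

lemma deriv_brownianAverage (hF : HasPowerDerivBound κ F) (hκ : 0 < κ) (hκ1 : κ ≤ 1)
    {t : ℝ} (ht : 0 < t) : deriv (brownianAverage F) t =
      ∫ v in Set.Ioi 0, deriv F v * (v / t * heatKernel v t) := by
  rw [(hF.hasDerivAt_brownianAverage hκ hκ1 ht).deriv, brownianAverage_eq _ ht,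
    ← integral_const_mul]
  congr 1 with v
  field_simp

/-- The `κ`-th absolute moment of `B(t)` is a multiple of `t^(κ/2)`, hence the halved exponent. This
keeps the class stable under iteration. -/
lemma brownianAverage (hF : HasPowerDerivBound κ F) (hκ : 0 < κ) (hκ1 : κ ≤ 1) :
    HasPowerDerivBound (κ / 2) (brownianAverage F) where
  measurable := measurable_brownianAverage hF.measurable
  bounded := hF.bounded.imp fun C hC => abs_brownianAverage_le hC
  differentiableAt s hs := (hF.hasDerivAt_brownianAverage hκ hκ1 hs).differentiableAt
  deriv_le := by
    obtain ⟨D, hD⟩ := hF.deriv_le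
    refine ⟨D * (gaussianAbsMoment κ / 2), fun t ht => ?_⟩
    have h1 := brownianAverage_rpow (r := κ) (by linarith) ht
    rw [brownianAverage_eq _ ht] at h1
    rw [hF.deriv_brownianAverage hκ hκ1 ht, ← Real.norm_eq_abs]
    have h2 : IntegrableOn (fun v => D / t * (heatKernel v t * v ^ κ)) (Set.Ioi 0) :=
      (integrableOn_heatKernel_mul_rpow (by linarith) ht).const_mul _
    refine (norm_integral_le_of_norm_le h2 ?_).trans (le_of_eq ?_)
    · filter_upwards [ae_restrict_mem measurableSet_Ioi] with v hv
      have hv0 : 0 < v := hv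
      have := heatKernel_nonneg v t
      rw [norm_mul, Real.norm_eq_abs, Real.norm_of_nonneg (by positivity)]
      calc |deriv F v| * (v / t * heatKernel v t)
          ≤ D * v ^ (κ - 1) * (v / t * heatKernel v t) := by gcongr; exact hD v hv0
        _ = _ := by rw [Real.rpow_sub_one hv0.ne']; field_simp
    · rw [integral_const_mul, Real.rpow_sub_one ht.ne']
      linear_combination (D / t / 2) * h1

end HasPowerDerivBound

lemma integral_Ioi_shift {g : ℝ → ℝ} {u : ℝ} (hu : 0 ≤ u)
    (hint : IntegrableOn (fun y => g (u + y)) (Set.Ioi 0)) :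
    IntegrableOn ((Set.Ioi u).indicator g) (Set.Ioi 0) ∧
      ∫ w in Set.Ioi 0, (Set.Ioi u).indicator g w = ∫ y in Set.Ioi 0, g (u + y) := by
  have h1 : ∀ y, (Set.Ioi 0).indicator (fun y => g (u + y)) y = (Set.Ioi u).indicator g (u + y) := by
    intro y
    simp [Set.indicator_apply]
  have hmin : (Set.Ioi 0 ∩ Set.Ioi u : Set ℝ) = Set.Ioi u :=
    Set.inter_eq_right.2 (Set.Ioi_subset_Ioi hu)
  constructor
  · rw [← integrable_indicator_iff measurableSet_Ioi] at hint ⊢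
    rw [Set.indicator_indicator, hmin]
    simpa using (hint.congr (ae_of_all _ h1)).comp_add_left (-u)
  · rw [setIntegral_indicator measurableSet_Ioi, hmin, ← integral_indicator measurableSet_Ioi,
      ← integral_indicator measurableSet_Ioi, ← integral_add_left_eq_self _ u]
    exact integral_congr_ae (ae_of_all _ fun y => (h1 y).symm)

namespace HasPowerDerivBound

variable {κ : ℝ} {F : ℝ → ℝ}

lemma integrableOn_deriv_mul (hF : HasPowerDerivBound κ F) (hκ : 0 < κ) {t : ℝ} (ht : 0 < t)
    {M : ℝ → ℝ} (hM : AEStronglyMeasurable M (volume.restrict (Set.Ioi 0)))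
    {C : ℝ} (hMC : ∀ v, 0 < v → |M v| ≤ C * heatKernel v t) :
    IntegrableOn (fun v => deriv F v * M v) (Set.Ioi 0) := by
  obtain ⟨D, hD⟩ := hF.deriv_le
  have h1 := (integrableOn_heatKernel_mul_rpow (r := κ - 1) (by linarith) ht).const_mul (D * C)
  refine Integrable.mono' h1 ((measurable_deriv F).aestronglyMeasurable.mul hM) ?_
  filter_upwards [ae_restrict_mem measurableSet_Ioi] with v hv
  have hv0 : 0 < v := hv
  rw [norm_mul, Real.norm_eq_abs, Real.norm_eq_abs]
  calc |deriv F v| * |M v| ≤ (D * v ^ (κ - 1)) * (C * heatKernel v t) :=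
        mul_le_mul (hD v hv0) (hMC v hv0) (abs_nonneg _) ((abs_nonneg _).trans (hD v hv0))
    _ = _ := by ring

/-- The fractional integral of the derivative of the Brownian average of `F`, in terms of the
derivative of `F`. -/
lemma integral_deriv_brownianAverage (hF : HasPowerDerivBound κ F) (hκ : 0 < κ) (hκ1 : κ ≤ 1)
    {γ t : ℝ} (hγ : γ ≤ 1) (ht : 0 < t) :
    IntegrableOn (fun s => deriv (_root_.brownianAverage F) s / (t - s) ^ (γ / 2)) (Set.Ioo 0 t) ∧
      ∫ s in Set.Ioo 0 t, deriv (_root_.brownianAverage F) s / (t - s) ^ (γ / 2) =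
        ∫ v in Set.Ioi 0, deriv F v *
          ∫ s in Set.Ioo 0 t, v / s * heatKernel v s * (t - s) ^ (-γ / 2) := by
  obtain ⟨C, hC⟩ := exists_integral_first_passage_le hγ ht
  set h : ℝ → ℝ → ℝ := fun s v => v / s * heatKernel v s * (t - s) ^ (-γ / 2) with hh
  have hmd : Measurable (deriv F) := measurable_deriv F
  have hm : Measurable (Function.uncurry h) := by
    simp only [hh, Function.uncurry_def]
    fun_prop
  have hpos : ∀ s ∈ Set.Ioo 0 t, ∀ v, 0 < v → 0 ≤ h s v := fun s hs v hv =>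
    first_passage_nonneg hv.le hs.1.le _ _ hs.2.le
  have hM : AEStronglyMeasurable (fun v => ∫ s in Set.Ioo 0 t, h s v)
      (volume.restrict (Set.Ioi 0)) :=
    (hm.stronglyMeasurable.integral_prod_left (μ := volume.restrict (Set.Ioo 0 t))).aestronglyMeasurable
  have hint : Integrable (Function.uncurry fun s v => deriv F v * h s v)
      ((volume.restrict (Set.Ioo 0 t)).prod (volume.restrict (Set.Ioi 0))) := by
    have hm' : Measurable (Function.uncurry fun s v => deriv F v * h s v) := by
      simp only [hh, Function.uncurry_def]
      fun_prop
    rw [integrable_prod_iff' hm'.aestronglyMeasurable]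
    constructor
    · filter_upwards [ae_restrict_mem measurableSet_Ioi] with v hv
      have h1 := Integrable.const_mul (hC v hv).1 (deriv F v)
      exact h1
    · have h1 := (hF.integrableOn_deriv_mul hκ ht hM (C := C) ?_).norm
      · refine h1.congr ?_
        filter_upwards [ae_restrict_mem measurableSet_Ioi] with v hv
        rw [norm_mul, Real.norm_of_nonneg (setIntegral_nonneg measurableSet_Ioo
          fun s hs => hpos s hs v hv), ← integral_const_mul]
        refine setIntegral_congr_fun measurableSet_Ioo fun s hs => ?_
        simp only [Function.uncurry_apply_pair, norm_mul, Real.norm_of_nonneg (hpos s hs v hv)]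
      · intro v hv
        rw [abs_of_nonneg (setIntegral_nonneg measurableSet_Ioo fun s hs => hpos s hs v hv)]
        exact (hC v hv).2
  have heq : ∀ s ∈ Set.Ioo 0 t, ∫ v in Set.Ioi 0, deriv F v * h s v =
      deriv (_root_.brownianAverage F) s / (t - s) ^ (γ / 2) := by
    intro s hs
    rw [hF.deriv_brownianAverage hκ hκ1 hs.1, div_eq_mul_inv,
      ← Real.rpow_neg (sub_nonneg.2 hs.2.le), ← neg_div, ← integral_mul_const]
    simp only [hh, mul_assoc]
  constructor
  · have h1 : IntegrableOn (fun s => ∫ v in Set.Ioi 0, deriv F v * h s v) (Set.Ioo 0 t) :=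
      hint.integral_prod_left
    exact h1.congr_fun heq measurableSet_Ioo
  · rw [← setIntegral_congr_fun measurableSet_Ioo heq, integral_integral_swap hint]
    simp only [integral_const_mul, hh]

/-- Fubini over the region `0 < u < w`, followed by the substitution `w = u + y`; the result matches
the right side of `integral_first_passage_mul_rpow`. -/
lemma brownianAverage_fractional_integral (hF : HasPowerDerivBound κ F) (hκ : 0 < κ)
    {γ t : ℝ} (hγ : γ < 1) (ht : 0 < t) :
    _root_.brownianAverage (fun w => ∫ u in Set.Ioo 0 w, deriv F u / (w - u) ^ γ) t =
      2 * ∫ v in Set.Ioi 0, deriv F v * ∫ y in Set.Ioi 0, heatKernel (v + y) t * y ^ (-γ) := by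
  rw [brownianAverage_eq _ ht]
  congr 1
  have hmd : Measurable (deriv F) := measurable_deriv F
  -- The indicator of `u < w` replaces the triangular region by a product of half lines.
  set k : ℝ → ℝ → ℝ := fun u w =>
    (Set.Ioi u).indicator (fun w => heatKernel w t * (w - u) ^ (-γ)) w with hk
  have hkm : Measurable (Function.uncurry k) := by
    have : Function.uncurry k = {p : ℝ × ℝ | p.1 < p.2}.indicator
        (fun p => heatKernel p.2 t * (p.2 - p.1) ^ (-γ)) := by
      ext ⟨u, w⟩
      simp [hk, Set.indicator_apply]
    rw [this]
    exact Measurable.indicator (by fun_prop) (measurableSet_lt measurable_fst measurable_snd)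
  have hk0 : ∀ u w, 0 ≤ k u w := fun u w => Set.indicator_nonneg (fun w hw =>
    mul_nonneg (heatKernel_nonneg _ _) (Real.rpow_nonneg (sub_nonneg.2 (le_of_lt hw)) _)) w
  have hki : ∀ u, 0 < u → IntegrableOn (k u) (Set.Ioi 0) ∧ ∫ w in Set.Ioi 0, k u w =
      ∫ y in Set.Ioi 0, heatKernel (u + y) t * y ^ (-γ) := by
    intro u hu
    have := integral_Ioi_shift (g := fun w => heatKernel w t * (w - u) ^ (-γ)) hu.le
    simp only [add_sub_cancel_left] at this
    exact this (integrableOn_heatKernel_add_mul_rpow hγ hu.le ht)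
  have hkC : ∀ u, 0 < u → |∫ w in Set.Ioi 0, k u w| ≤ (√(2 * Real.pi * t) *
      ∫ y in Set.Ioi 0, heatKernel y t * y ^ (-γ)) * heatKernel u t := by
    intro u hu
    rw [abs_of_nonneg (integral_nonneg (hk0 u)), (hki u hu).2, mul_comm _ (heatKernel u t),
      ← mul_assoc, ← integral_const_mul]
    refine setIntegral_mono_on (integrableOn_heatKernel_add_mul_rpow hγ hu.le ht)
      ((integrableOn_heatKernel_mul_rpow (by linarith) ht).const_mul _) measurableSet_Ioi ?_
    intro y hy
    have hy' : 0 ≤ y := le_of_lt hy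
    rw [← mul_assoc]
    exact mul_le_mul_of_nonneg_right (heatKernel_add_le hu.le hy' ht) (Real.rpow_nonneg hy' _)
  have hM : AEStronglyMeasurable (fun u => ∫ w in Set.Ioi 0, k u w)
      (volume.restrict (Set.Ioi 0)) :=
    (hkm.stronglyMeasurable.integral_prod_right (ν := volume.restrict (Set.Ioi 0))).aestronglyMeasurable
  have hint : Integrable (Function.uncurry fun u w => deriv F u * k u w)
      ((volume.restrict (Set.Ioi 0)).prod (volume.restrict (Set.Ioi 0))) := by
    have hm' : Measurable (Function.uncurry fun u w => deriv F u * k u w) :=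
      (hmd.comp measurable_fst).mul hkm
    rw [integrable_prod_iff hm'.aestronglyMeasurable]
    constructor
    · filter_upwards [ae_restrict_mem measurableSet_Ioi] with u hu
      have h1 := Integrable.const_mul (hki u hu).1 (deriv F u)
      exact h1
    · refine (hF.integrableOn_deriv_mul hκ ht hM hkC).norm.congr ?_
      filter_upwards [ae_restrict_mem measurableSet_Ioi] with u hu
      rw [norm_mul, Real.norm_of_nonneg (integral_nonneg (hk0 u)), ← integral_const_mul]
      simp only [Function.uncurry_apply_pair, norm_mul, Real.norm_of_nonneg (hk0 _ _)]
  have h1 : ∀ w ∈ Set.Ioi (0 : ℝ), ∫ u in Set.Ioi 0, deriv F u * k u w =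
      heatKernel w t * ∫ u in Set.Ioo 0 w, deriv F u / (w - u) ^ γ := by
    intro w hw
    have h2 : ∀ u, deriv F u * k u w = (Set.Iio w).indicator
        (fun u => heatKernel w t * (deriv F u / (w - u) ^ γ)) u := by
      intro u
      simp only [hk, Set.indicator_apply, Set.mem_Ioi, Set.mem_Iio]
      split_ifs with h
      · rw [Real.rpow_neg (sub_nonneg.2 h.le)]
        ring
      · simp
    simp only [h2]
    rw [setIntegral_indicator measurableSet_Iio, Set.Ioi_inter_Iio, integral_const_mul]
  rw [← setIntegral_congr_fun measurableSet_Ioi h1, ← integral_integral_swap hint]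
  refine setIntegral_congr_fun measurableSet_Ioi fun u hu => ?_
  rw [integral_const_mul, (hki u hu).2]

lemma _root_.brownianAverage_congr {f g : ℝ → ℝ} {t : ℝ} (ht : 0 < t)
    (h : ∀ w, 0 < w → f w = g w) : _root_.brownianAverage f t = _root_.brownianAverage g t := by
  rw [brownianAverage_eq _ ht, brownianAverage_eq _ ht]
  congr 1
  exact setIntegral_congr_fun measurableSet_Ioi fun w hw => by rw [h w hw]

lemma _root_.brownianAverage_const_mul (c : ℝ) (f : ℝ → ℝ) (t : ℝ) :
    _root_.brownianAverage (fun w => c * f w) t = c * _root_.brownianAverage f t :=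
  integral_const_mul _ _

/-- Averaging over a Brownian motion halves the order of a Caputo derivative. -/
lemma hasCaputoDerivAt_brownianAverage (hF : HasPowerDerivBound κ F) (hκ : 0 < κ) (hκ1 : κ ≤ 1)
    {γ : ℝ} {d : ℝ → ℝ} (hd : ∀ v, 0 < v → HasCaputoDerivAt γ F (d v) v) {t : ℝ} (ht : 0 < t) :
    HasCaputoDerivAt (γ / 2) (_root_.brownianAverage F)
      (2 ^ (-γ / 2) * _root_.brownianAverage d t) t := by
  have hγ : 0 < γ ∧ γ ≤ 1 := by
    rcases hd t ht with ⟨rfl, -⟩ | ⟨h0, h1, -⟩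
    exacts [⟨one_pos, le_rfl⟩, ⟨h0, h1.le⟩]
  obtain ⟨hint, heq⟩ := hF.integral_deriv_brownianAverage hκ hκ1 hγ.2 ht
  refine Or.inr ⟨by linarith, by linarith, fun s hs =>
    (hF.hasDerivAt_brownianAverage hκ hκ1 hs.1).differentiableAt, hint, ?_⟩
  rw [heq]
  -- For `γ = 1` the given derivative is the ordinary one, and the constants match through `√(2π) /
  -- Γ(1/2) = √2 = 2 · 2^(-1/2)`.
  rcases hγ.2.eq_or_lt with rfl | hγ1
  · have hd' : ∀ v, 0 < v → d v = deriv F v := by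
      intro v hv
      rcases hd v hv with ⟨-, h⟩ | ⟨-, h, -⟩
      exacts [h.deriv.symm, absurd h (lt_irrefl _)]
    rw [brownianAverage_congr ht hd', brownianAverage_eq _ ht]
    have h1 : ∫ v in Set.Ioi 0, deriv F v *
        (∫ s in Set.Ioo 0 t, v / s * heatKernel v s * (t - s) ^ (-1 / 2 : ℝ)) =
        √(2 * Real.pi) * ∫ v in Set.Ioi 0, heatKernel v t * deriv F v := by
      rw [← integral_const_mul]
      refine setIntegral_congr_fun measurableSet_Ioi fun v hv => ?_
      rw [(integral_first_passage_mul_rpow_half hv ht).2]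
      ring
    rw [h1, show (1 : ℝ) - 1 / 2 = 1 / 2 by norm_num, Real.Gamma_one_half_eq,
      Real.sqrt_mul zero_le_two, show (-1 / 2 : ℝ) = 1 / 2 - 1 by norm_num,
      Real.rpow_sub_one two_ne_zero, ← Real.sqrt_eq_rpow]
    have : √Real.pi ≠ 0 := by positivity
    field_simp
  · have hd' : ∀ v, 0 < v → d v = 1 / Real.Gamma (1 - γ) *
        ∫ u in Set.Ioo 0 v, deriv F u / (v - u) ^ γ := by
      intro v hv
      rcases hd v hv with ⟨h, -⟩ | ⟨-, -, -, -, h⟩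
      exacts [absurd h hγ1.ne, h.symm]
    rw [brownianAverage_congr ht hd', brownianAverage_const_mul,
      hF.brownianAverage_fractional_integral hκ hγ1 ht]
    have hK := gaussianAbsMoment_pos (r := -γ) (by linarith)
    have h1 : gaussianAbsMoment (-γ) / 2 * ∫ v in Set.Ioi 0, deriv F v *
        (∫ s in Set.Ioo 0 t, v / s * heatKernel v s * (t - s) ^ (-γ / 2 : ℝ)) =
        ∫ v in Set.Ioi 0, deriv F v * ∫ y in Set.Ioi 0, heatKernel (v + y) t * y ^ (-γ) := by
      rw [← integral_const_mul]
      refine setIntegral_congr_fun measurableSet_Ioi fun v hv => ?_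
      rw [← (integral_first_passage_mul_rpow hγ1 hv ht).2]
      ring
    rw [← h1]
    have hG := gaussianAbsMoment_neg γ
    have hG1 := Real.Gamma_pos_of_pos (s := 1 - γ / 2) (by linarith)
    have hG2 := Real.Gamma_pos_of_pos (s := 1 - γ) (by linarith)
    have h2 : (2 : ℝ) ^ (-γ / 2) * 2 ^ (γ / 2) = 1 := by
      rw [← Real.rpow_add two_pos]; simp [neg_div]
    set J := ∫ v in Set.Ioi 0, deriv F v *
        (∫ s in Set.Ioo 0 t, v / s * heatKernel v s * (t - s) ^ (-γ / 2 : ℝ))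
    rw [one_div_mul_eq_div, one_div_mul_eq_div, mul_div_assoc', div_eq_div_iff hG1.ne' hG2.ne']
    linear_combination (-J * 2 ^ (-γ / 2)) * hG - J * Real.Gamma (1 - γ) * h2

end HasPowerDerivBound

lemma HasCaputoDerivAt.const_mul {α d t : ℝ} {f : ℝ → ℝ} (h : HasCaputoDerivAt α f d t) (c : ℝ) :
    HasCaputoDerivAt α (fun s => c * f s) (c * d) t := by
  rcases h with ⟨rfl, h⟩ | ⟨h0, h1, hd, hi, hv⟩
  · exact Or.inl ⟨rfl, h.const_mul c⟩
  · have heq : ∀ s ∈ Set.Ioo 0 t, c * (deriv f s / (t - s) ^ α) =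
        deriv (fun s => c * f s) s / (t - s) ^ α := fun s hs => by
      rw [deriv_const_mul _ (hd s hs), mul_div_assoc]
    refine Or.inr ⟨h0, h1, fun s hs => (hd s hs).const_mul c, ?_, ?_⟩
    · have h2 := Integrable.const_mul hi c
      exact IntegrableOn.congr_fun h2 heq measurableSet_Ioo
    · rw [← setIntegral_congr_fun measurableSet_Ioo heq, integral_const_mul, ← hv]
      ring

/-- Needed because the density is identified with an iterated average only at positive times. -/
lemma HasCaputoDerivAt.congr_of_eqOn_Ioi {α d t : ℝ} {f g : ℝ → ℝ}
    (h : HasCaputoDerivAt α f d t) (hfg : ∀ s, 0 < s → g s = f s) (ht : 0 < t) :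
    HasCaputoDerivAt α g d t := by
  have heq : ∀ s, 0 < s → g =ᶠ[𝓝 s] f := fun s hs => by
    filter_upwards [Ioi_mem_nhds hs] with u hu using hfg u hu
  rcases h with ⟨rfl, h⟩ | ⟨h0, h1, hd, hi, hv⟩
  · exact Or.inl ⟨rfl, h.congr_of_eventuallyEq (heq t ht)⟩
  · have hderiv : ∀ s ∈ Set.Ioo 0 t, deriv f s / (t - s) ^ α = deriv g s / (t - s) ^ α :=
      fun s hs => by rw [(heq s hs.1).deriv_eq]
    exact Or.inr ⟨h0, h1, fun s hs => (hd s hs).congr_of_eventuallyEq (heq s hs.1),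
      IntegrableOn.congr_fun hi hderiv measurableSet_Ioo,
      by rw [← setIntegral_congr_fun measurableSet_Ioo hderiv, hv]⟩

/-! ### The Cauchy kernel: bounds, harmonicity, regularity in space. -/

/-- The conjugate Poisson kernel `s / (s² + x²)`, up to a factor the Cauchy density. -/
noncomputable def cauchyKernel (x s : ℝ) : ℝ := s / (s ^ 2 + x ^ 2)

/-- The first derivative of `cauchyKernel` in `x`. -/
noncomputable def cauchyKernelDeriv (x s : ℝ) : ℝ := -2 * x * s / (s ^ 2 + x ^ 2) ^ 2

/-- The second derivative of `cauchyKernel` in `x`. -/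
noncomputable def cauchyKernelDeriv₂ (x s : ℝ) : ℝ :=
  (6 * x ^ 2 * s - 2 * s ^ 3) / (s ^ 2 + x ^ 2) ^ 3

@[fun_prop] lemma measurable_cauchyKernel (x : ℝ) : Measurable (cauchyKernel x) := by
  unfold cauchyKernel; fun_prop

@[fun_prop] lemma measurable_cauchyKernelDeriv (x : ℝ) : Measurable (cauchyKernelDeriv x) := by
  unfold cauchyKernelDeriv; fun_prop

@[fun_prop] lemma measurable_cauchyKernelDeriv₂ (x : ℝ) : Measurable (cauchyKernelDeriv₂ x) := by
  unfold cauchyKernelDeriv₂; fun_prop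

lemma abs_mul_abs_le_sq_add_sq (x s : ℝ) : |x| * |s| ≤ s ^ 2 + x ^ 2 := by
  rw [← sq_abs s, ← sq_abs x]
  nlinarith [sq_nonneg (|x| - |s|), sq_nonneg |x|, sq_nonneg |s|]

section Bounds

variable {r x : ℝ} (s : ℝ)

lemma abs_cauchyKernel_le (hr : 0 < r) (hx : r ≤ |x|) : |cauchyKernel x s| ≤ 1 / r := by
  have hx0 : 0 < |x| := hr.trans_le hx
  have hx2 : 0 < x ^ 2 := by rw [← sq_abs]; positivity
  have h := abs_mul_abs_le_sq_add_sq x s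
  rw [cauchyKernel, abs_div, abs_of_pos (by positivity : 0 < s ^ 2 + x ^ 2),
    div_le_div_iff₀ (by positivity) hr]
  nlinarith [mul_le_mul_of_nonneg_right hx (abs_nonneg s)]

lemma abs_cauchyKernelDeriv_le (hr : 0 < r) (hx : r ≤ |x|) :
    |cauchyKernelDeriv x s| ≤ 2 / r ^ 2 := by
  have hx0 : 0 < |x| := hr.trans_le hx
  have hx2 : 0 < x ^ 2 := by rw [← sq_abs]; positivity
  have hrx : r ^ 2 ≤ x ^ 2 := by rw [← sq_abs x]; gcongr
  have h := abs_mul_abs_le_sq_add_sq x s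
  have hD : r ^ 2 ≤ s ^ 2 + x ^ 2 := by nlinarith [sq_nonneg s]
  rw [cauchyKernelDeriv, abs_div, abs_of_pos (by positivity : 0 < (s ^ 2 + x ^ 2) ^ 2),
    div_le_div_iff₀ (by positivity) (by positivity), abs_mul, abs_mul, abs_neg, abs_two]
  calc 2 * |x| * |s| * r ^ 2 = 2 * (|x| * |s|) * r ^ 2 := by ring
    _ ≤ 2 * (s ^ 2 + x ^ 2) * (s ^ 2 + x ^ 2) := by gcongr
    _ = _ := by ring

lemma abs_cauchyKernelDeriv₂_le (hr : 0 < r) (hx : r ≤ |x|) :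
    |cauchyKernelDeriv₂ x s| ≤ 6 / r ^ 3 := by
  have hx0 : 0 < |x| := hr.trans_le hx
  have hx2 : 0 < x ^ 2 := by rw [← sq_abs]; positivity
  have hrx : r ^ 2 ≤ x ^ 2 := by rw [← sq_abs x]; gcongr
  have h := abs_mul_abs_le_sq_add_sq x s
  have hD : r ^ 2 ≤ s ^ 2 + x ^ 2 := by nlinarith [sq_nonneg s]
  have h1 : |6 * x ^ 2 * s - 2 * s ^ 3| ≤ 6 * (s ^ 2 + x ^ 2) * |s| := by
    rw [show 6 * x ^ 2 * s - 2 * s ^ 3 = (6 * x ^ 2 - 2 * s ^ 2) * s by ring, abs_mul]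
    gcongr
    rw [abs_le]
    constructor <;> nlinarith [sq_nonneg s]
  have h2 : r * |s| ≤ s ^ 2 + x ^ 2 := (mul_le_mul_of_nonneg_right hx (abs_nonneg s)).trans h
  rw [cauchyKernelDeriv₂, abs_div, abs_of_pos (by positivity : 0 < (s ^ 2 + x ^ 2) ^ 3),
    div_le_div_iff₀ (by positivity) (by positivity)]
  calc |6 * x ^ 2 * s - 2 * s ^ 3| * r ^ 3 ≤ 6 * (s ^ 2 + x ^ 2) * |s| * r ^ 3 := by gcongr
    _ = 6 * (s ^ 2 + x ^ 2) * (r * |s|) * r ^ 2 := by ring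
    _ ≤ 6 * (s ^ 2 + x ^ 2) * (s ^ 2 + x ^ 2) * (s ^ 2 + x ^ 2) := by gcongr
    _ = _ := by ring

end Bounds

lemma hasDerivAt_cauchyKernel_left {x : ℝ} (hx : x ≠ 0) (s : ℝ) :
    HasDerivAt (fun y => cauchyKernel y s) (cauchyKernelDeriv x s) x := by
  have hx2 : 0 < x ^ 2 := by positivity
  have hD : s ^ 2 + x ^ 2 ≠ 0 := by positivity
  have h := (hasDerivAt_const x s).fun_div (((hasDerivAt_id' x).fun_pow 2).const_add (s ^ 2)) hD
  refine h.congr_deriv ?_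
  simp only [cauchyKernelDeriv]
  field_simp
  ring

lemma hasDerivAt_cauchyKernelDeriv_left {x : ℝ} (hx : x ≠ 0) (s : ℝ) :
    HasDerivAt (fun y => cauchyKernelDeriv y s) (cauchyKernelDeriv₂ x s) x := by
  have hx2 : 0 < x ^ 2 := by positivity
  have hD : s ^ 2 + x ^ 2 ≠ 0 := by positivity
  have h := (((hasDerivAt_id' x).const_mul (-2)).mul_const s).fun_div
    ((((hasDerivAt_id' x).fun_pow 2).const_add (s ^ 2)).fun_pow 2) (pow_ne_zero 2 hD)
  refine h.congr_deriv ?_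
  simp only [cauchyKernelDeriv₂]
  field_simp
  ring

lemma continuousAt_cauchyKernelDeriv₂_left {x : ℝ} (hx : x ≠ 0) (s : ℝ) :
    ContinuousAt (fun y => cauchyKernelDeriv₂ y s) x := by
  have hx2 : 0 < x ^ 2 := by positivity
  have hD : (s ^ 2 + x ^ 2) ^ 3 ≠ 0 := by positivity
  unfold cauchyKernelDeriv₂
  fun_prop (disch := exact hD)

lemma hasDerivAt_cauchyKernel_right {x : ℝ} (hx : x ≠ 0) (s : ℝ) :
    HasDerivAt (cauchyKernel x) ((x ^ 2 - s ^ 2) / (s ^ 2 + x ^ 2) ^ 2) s := by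
  have hx2 : 0 < x ^ 2 := by positivity
  have hD : s ^ 2 + x ^ 2 ≠ 0 := by positivity
  have h := (hasDerivAt_id' s).fun_div (((hasDerivAt_id' s).fun_pow 2).add_const (x ^ 2)) hD
  refine h.congr_deriv ?_
  congr 1
  ring

/-- Harmonicity of the kernel in `(x, s)`: its second derivative in `s` is minus the one in `x`. -/
lemma hasDerivAt_deriv_cauchyKernel_right {x : ℝ} (hx : x ≠ 0) (s : ℝ) :
    HasDerivAt (fun s => (x ^ 2 - s ^ 2) / (s ^ 2 + x ^ 2) ^ 2) (-cauchyKernelDeriv₂ x s) s := by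
  have hx2 : 0 < x ^ 2 := by positivity
  have hD : s ^ 2 + x ^ 2 ≠ 0 := by positivity
  have h := (((hasDerivAt_id' s).fun_pow 2).const_sub (x ^ 2)).fun_div
    ((((hasDerivAt_id' s).fun_pow 2).add_const (x ^ 2)).fun_pow 2) (pow_ne_zero 2 hD)
  refine h.congr_deriv ?_
  simp only [cauchyKernelDeriv₂]
  field_simp
  ring

lemma hasDerivAt_integral_mul_of_bounded {φ φ' : ℝ → ℝ → ℝ} {ρ : ℝ → ℝ} {S : Set ℝ} {x : ℝ}
    (hx : x ≠ 0) (hρ : IntegrableOn ρ S) (hφ : ∀ y, Measurable (φ y))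
    (hφ' : ∀ y, Measurable (φ' y))
    (hd : ∀ y s, y ≠ 0 → HasDerivAt (fun y => φ y s) (φ' y s) y)
    (hb : ∀ r, 0 < r → ∃ C, ∀ y s, r ≤ |y| → |φ y s| ≤ C)
    (hb' : ∀ r, 0 < r → ∃ C, ∀ y s, r ≤ |y| → |φ' y s| ≤ C) :
    HasDerivAt (fun y => ∫ s in S, φ y s * ρ s) (∫ s in S, φ' x s * ρ s) x := by
  have hr : 0 < |x| / 2 := by positivity
  obtain ⟨C, hC⟩ := hb _ hr
  obtain ⟨D, hD⟩ := hb' _ hr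
  -- A neighbourhood of `x` kept away from the origin, where the kernels are bounded uniformly in
  -- `s`.
  have hU : {y : ℝ | |x| / 2 < |y|} ∈ 𝓝 x :=
    (isOpen_lt continuous_const continuous_abs).mem_nhds (half_lt_self (abs_pos.2 hx))
  refine (hasDerivAt_integral_of_dominated_loc_of_deriv_le (F := fun y s => φ y s * ρ s)
    (F' := fun y s => φ' y s * ρ s) (bound := fun s => D * ‖ρ s‖) hU
    (Eventually.of_forall fun y => (hφ y).aestronglyMeasurable.mul hρ.aestronglyMeasurable)
    (hρ.bdd_mul (c := C) (hφ x).aestronglyMeasurable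
      (ae_of_all _ fun s => hC x s (half_le_self (abs_nonneg x))))
    ((hφ' x).aestronglyMeasurable.mul hρ.aestronglyMeasurable)
    (ae_of_all _ fun s y hy => ?_) (hρ.norm.const_mul D) (ae_of_all _ fun s y hy => ?_)).2
  · rw [norm_mul]
    exact mul_le_mul_of_nonneg_right (hD y s (le_of_lt hy)) (norm_nonneg _)
  · have hy0 : y ≠ 0 := abs_pos.1 (hr.trans hy)
    exact (hd y s hy0).mul_const _

section SpaceRegularity

variable {ρ : ℝ → ℝ} {S : Set ℝ} {x : ℝ}

lemma hasDerivAt_integral_cauchyKernel (hx : x ≠ 0) (hρ : IntegrableOn ρ S) :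
    HasDerivAt (fun y => ∫ s in S, cauchyKernel y s * ρ s)
      (∫ s in S, cauchyKernelDeriv x s * ρ s) x :=
  hasDerivAt_integral_mul_of_bounded hx hρ (by fun_prop) (by fun_prop)
    (fun _ s hy => hasDerivAt_cauchyKernel_left hy s)
    (fun r hr => ⟨_, fun _ s hy => abs_cauchyKernel_le s hr hy⟩)
    (fun r hr => ⟨_, fun _ s hy => abs_cauchyKernelDeriv_le s hr hy⟩)

lemma hasDerivAt_integral_cauchyKernelDeriv (hx : x ≠ 0) (hρ : IntegrableOn ρ S) :
    HasDerivAt (fun y => ∫ s in S, cauchyKernelDeriv y s * ρ s)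
      (∫ s in S, cauchyKernelDeriv₂ x s * ρ s) x :=
  hasDerivAt_integral_mul_of_bounded hx hρ (by fun_prop) (by fun_prop)
    (fun _ s hy => hasDerivAt_cauchyKernelDeriv_left hy s)
    (fun r hr => ⟨_, fun _ s hy => abs_cauchyKernelDeriv_le s hr hy⟩)
    (fun r hr => ⟨_, fun _ s hy => abs_cauchyKernelDeriv₂_le s hr hy⟩)

lemma continuousAt_integral_cauchyKernelDeriv₂ (hx : x ≠ 0) (hρ : IntegrableOn ρ S) :
    ContinuousAt (fun y => ∫ s in S, cauchyKernelDeriv₂ y s * ρ s) x := by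
  have hr : 0 < |x| / 2 := by positivity
  have hU : {y : ℝ | |x| / 2 < |y|} ∈ 𝓝 x :=
    (isOpen_lt continuous_const continuous_abs).mem_nhds (half_lt_self (abs_pos.2 hx))
  refine continuousAt_of_dominated (bound := fun s => 6 / (|x| / 2) ^ 3 * ‖ρ s‖)
    (Eventually.of_forall fun y =>
      (measurable_cauchyKernelDeriv₂ y).aestronglyMeasurable.mul hρ.aestronglyMeasurable)
    ?_ (hρ.norm.const_mul _)
    (ae_of_all _ fun s => (continuousAt_cauchyKernelDeriv₂_left hx s).mul continuousAt_const)
  filter_upwards [hU] with y hy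
  refine ae_of_all _ fun s => ?_
  rw [norm_mul]
  exact mul_le_mul_of_nonneg_right (abs_cauchyKernelDeriv₂_le s hr (le_of_lt hy)) (norm_nonneg _)

lemma contDiffAt_integral_cauchyKernel (hx : x ≠ 0) (hρ : IntegrableOn ρ S) :
    ContDiffAt ℝ 2 (fun y => ∫ s in S, cauchyKernel y s * ρ s) x ∧
      iteratedDeriv 2 (fun y => ∫ s in S, cauchyKernel y s * ρ s) x =
        ∫ s in S, cauchyKernelDeriv₂ x s * ρ s := by
  have hopen : IsOpen ({0}ᶜ : Set ℝ) := isOpen_compl_singleton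
  have h1 : ∀ y ∈ ({0}ᶜ : Set ℝ), deriv (fun y => ∫ s in S, cauchyKernel y s * ρ s) y =
      ∫ s in S, cauchyKernelDeriv y s * ρ s := fun y hy =>
    (hasDerivAt_integral_cauchyKernel hy hρ).deriv
  have h2 : ∀ y ∈ ({0}ᶜ : Set ℝ), deriv (fun y => ∫ s in S, cauchyKernelDeriv y s * ρ s) y =
      ∫ s in S, cauchyKernelDeriv₂ y s * ρ s := fun y hy =>
    (hasDerivAt_integral_cauchyKernelDeriv hy hρ).deriv
  constructor
  · refine ContDiffOn.contDiffAt (s := {0}ᶜ) ?_ (hopen.mem_nhds hx)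
    rw [show (2 : WithTop ℕ∞) = 1 + 1 by norm_num, contDiffOn_succ_iff_deriv_of_isOpen hopen]
    refine ⟨fun y hy =>
      (hasDerivAt_integral_cauchyKernel hy hρ).differentiableAt.differentiableWithinAt,
      by simp, ?_⟩
    rw [contDiffOn_congr h1, show (1 : WithTop ℕ∞) = 0 + 1 by norm_num,
      contDiffOn_succ_iff_deriv_of_isOpen hopen]
    refine ⟨fun y hy =>
      (hasDerivAt_integral_cauchyKernelDeriv hy hρ).differentiableAt.differentiableWithinAt,
      by simp, ?_⟩
    rw [contDiffOn_congr h2, contDiffOn_zero]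
    exact fun y hy => (continuousAt_integral_cauchyKernelDeriv₂ hy hρ).continuousWithinAt
  · rw [iteratedDeriv_succ, iteratedDeriv_one, ← h2 x hx]
    exact Filter.EventuallyEq.deriv_eq (by filter_upwards [hopen.mem_nhds hx] with y hy using h1 y hy)

end SpaceRegularity

/-! ### The fractional equation for the iterated averages of the kernel. -/

lemma hasPowerDerivBound_cauchyKernel {x : ℝ} (hx : x ≠ 0) :
    HasPowerDerivBound 1 (cauchyKernel x) where
  measurable := measurable_cauchyKernel x
  bounded := ⟨_, fun s => abs_cauchyKernel_le s (abs_pos.2 hx) le_rfl⟩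
  differentiableAt s _ := (hasDerivAt_cauchyKernel_right hx s).differentiableAt
  deriv_le := by
    refine ⟨1 / x ^ 2, fun s _ => ?_⟩
    have hx2 : 0 < x ^ 2 := by positivity
    rw [(hasDerivAt_cauchyKernel_right hx s).deriv, sub_self, Real.rpow_zero, mul_one, abs_div,
      abs_of_pos (by positivity : 0 < (s ^ 2 + x ^ 2) ^ 2),
      div_le_div_iff₀ (by positivity) (by positivity)]
    have h1 : |x ^ 2 - s ^ 2| ≤ s ^ 2 + x ^ 2 := by
      rw [abs_le]; constructor <;> nlinarith [sq_nonneg s]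
    nlinarith [mul_le_mul_of_nonneg_right h1 hx2.le, sq_nonneg s, mul_nonneg (sq_nonneg s) hx2.le]

lemma hasPowerDerivBound_iterate_cauchyKernel {x : ℝ} (hx : x ≠ 0) (n : ℕ) :
    HasPowerDerivBound (1 / 2 ^ n) (brownianAverage^[n] (cauchyKernel x)) := by
  induction n with
  | zero => simpa using hasPowerDerivBound_cauchyKernel hx
  | succ n ih =>
    rw [Function.iterate_succ_apply', pow_succ, ← div_div]
    refine ih.brownianAverage (by positivity) ?_
    rw [div_le_one (by positivity)]
    exact one_le_pow₀ one_le_two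

lemma hasDerivAt_heatKernel_left (w : ℝ) {t : ℝ} (ht : 0 < t) :
    HasDerivAt (fun w => heatKernel w t) (-(w / t * heatKernel w t)) w := by
  have h := ((((hasDerivAt_id' w).fun_pow 2).fun_neg.div_const (2 * t)).exp).div_const
    √(2 * Real.pi * t)
  refine h.congr_deriv ?_
  simp only [heatKernel]
  field_simp
  simp [mul_comm]

lemma tendsto_heatKernel_atTop {t : ℝ} (ht : 0 < t) :
    Tendsto (fun w => heatKernel w t) atTop (𝓝 0) := by
  have h : Tendsto (fun w : ℝ => -w ^ 2 / (2 * t)) atTop atBot := by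
    simp only [neg_div]
    exact tendsto_neg_atTop_atBot.comp
      ((tendsto_pow_atTop two_ne_zero).atTop_div_const (by positivity))
  simpa [heatKernel] using (Real.tendsto_exp_atBot.comp h).div_const √(2 * Real.pi * t)

lemma integrableOn_heatKernel_mul_of_bounded {f : ℝ → ℝ} (hf : Measurable f) {C : ℝ}
    (hC : ∀ w, |f w| ≤ C) {t : ℝ} (ht : 0 < t) :
    IntegrableOn (fun w => heatKernel w t * f w) (Set.Ioi 0) := by
  have := (integrable_heatKernel t ht.le).integrableOn (s := Set.Ioi 0)
  exact this.mul_bdd (c := C) hf.aestronglyMeasurable (ae_of_all _ hC)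

/-- The equation for a single Brownian motion, a consequence of the heat equation and the
harmonicity of the kernel. -/
lemma hasDerivAt_brownianAverage_cauchyKernel {x t : ℝ} (hx : x ≠ 0) (ht : 0 < t) :
    HasDerivAt (brownianAverage (cauchyKernel x))
      (-(1 / 2) * brownianAverage (cauchyKernelDeriv₂ x) t + heatKernel 0 t / x ^ 2) t := by
  have hF := hasPowerDerivBound_cauchyKernel hx
  have h1 := hF.hasDerivAt_brownianAverage one_pos le_rfl ht
  refine h1.congr_deriv ?_
  rw [← h1.deriv, hF.deriv_brownianAverage one_pos le_rfl ht]
  set D : ℝ → ℝ := fun s => (x ^ 2 - s ^ 2) / (s ^ 2 + x ^ 2) ^ 2 with hD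
  have hdD : deriv (cauchyKernel x) = D := funext fun s => (hasDerivAt_cauchyKernel_right hx s).deriv
  obtain ⟨B, hB⟩ := hF.deriv_le
  simp only [sub_self, Real.rpow_zero, mul_one] at hB
  have hi1 : IntegrableOn (fun w => heatKernel w t * cauchyKernelDeriv₂ x w) (Set.Ioi 0) :=
    integrableOn_heatKernel_mul_of_bounded (by fun_prop)
      (fun w => abs_cauchyKernelDeriv₂_le w (abs_pos.2 hx) le_rfl) ht
  have hi2 : IntegrableOn (fun w => D w * (w / t * heatKernel w t)) (Set.Ioi 0) := by
    have h2 := ((integrableOn_heatKernel_mul_rpow (r := 1) (by norm_num) ht).const_mul (B / t))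
    have hm : Measurable fun w => D w * (w / t * heatKernel w t) := by
      simp only [hD]; fun_prop
    refine Integrable.mono' h2 hm.aestronglyMeasurable ?_
    filter_upwards [ae_restrict_mem measurableSet_Ioi] with w hw
    have hw0 : 0 < w := hw
    have := heatKernel_nonneg w t
    rw [norm_mul, Real.norm_eq_abs, Real.norm_of_nonneg (by positivity), Real.rpow_one]
    calc |D w| * (w / t * heatKernel w t) ≤ B * (w / t * heatKernel w t) := by
          gcongr; rw [← hdD]; exact hB w hw0
      _ = _ := by ring
  -- Integration by parts. The product vanishes at infinity, and its value at `w = 0` is the source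
  -- term `heatKernel 0 t / x ^ 2`.
  have hderiv : ∀ w ∈ Set.Ici (0 : ℝ), HasDerivAt (fun w => D w * heatKernel w t)
      (-(heatKernel w t * cauchyKernelDeriv₂ x w) - D w * (w / t * heatKernel w t)) w := by
    intro w _
    refine ((hasDerivAt_deriv_cauchyKernel_right hx w).mul
      (hasDerivAt_heatKernel_left w ht)).congr_deriv ?_
    simp only [hD]
    ring
  have hlim : Tendsto (fun w => D w * heatKernel w t) atTop (𝓝 0) := by
    have h3 : Tendsto (fun w => B * heatKernel w t) atTop (𝓝 0) := by
      simpa using (tendsto_heatKernel_atTop ht).const_mul B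
    refine squeeze_zero_norm' ?_ h3
    filter_upwards [eventually_gt_atTop 0] with w hw
    rw [norm_mul, Real.norm_eq_abs, Real.norm_of_nonneg (heatKernel_nonneg _ _)]
    refine mul_le_mul_of_nonneg_right ?_ (heatKernel_nonneg _ _)
    rw [← hdD]; exact hB w hw
  have hftc := integral_Ioi_of_hasDerivAt_of_tendsto' hderiv (hi1.neg.sub hi2) hlim
  have hsub : ∫ w in Set.Ioi 0, (-(heatKernel w t * cauchyKernelDeriv₂ x w) -
      D w * (w / t * heatKernel w t)) = -(∫ w in Set.Ioi 0, heatKernel w t * cauchyKernelDeriv₂ x w) -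
      ∫ w in Set.Ioi 0, D w * (w / t * heatKernel w t) := by
    rw [← integral_neg]
    exact integral_sub hi1.neg hi2
  have hD0 : D 0 = 1 / x ^ 2 := by
    simp only [hD]
    field_simp
    ring
  rw [hsub, hD0] at hftc
  rw [hdD, brownianAverage_eq _ ht]
  linear_combination -hftc

lemma brownianAverage_add_rpow {f : ℝ → ℝ} (hf : Measurable f) {C : ℝ} (hC : ∀ w, |f w| ≤ C)
    (a b : ℝ) {r t : ℝ} (hr : -1 < r) (ht : 0 < t) :
    brownianAverage (fun w => a * f w + b * w ^ r) t =
      a * brownianAverage f t + b * (gaussianAbsMoment r * t ^ (r / 2)) := by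
  rw [← brownianAverage_rpow hr ht, brownianAverage_eq _ ht, brownianAverage_eq _ ht,
    brownianAverage_eq _ ht]
  have h : ∫ w in Set.Ioi 0, heatKernel w t * (a * f w + b * w ^ r) =
      a * (∫ w in Set.Ioi 0, heatKernel w t * f w) +
        b * ∫ w in Set.Ioi 0, heatKernel w t * w ^ r := by
    rw [← integral_const_mul, ← integral_const_mul, ← integral_add
      ((integrableOn_heatKernel_mul_of_bounded hf hC ht).const_mul a)
      ((integrableOn_heatKernel_mul_rpow hr ht).const_mul b)]
    congr 1 with w
    ring
  rw [h]
  ring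

/-- The fractional equation for the iterated Brownian averages of the Cauchy kernel. -/
lemma hasCaputoDerivAt_iterate_cauchyKernel {x : ℝ} (hx : x ≠ 0) (n : ℕ) {t : ℝ} (ht : 0 < t) :
    HasCaputoDerivAt (1 / 2 ^ n) (brownianAverage^[n + 1] (cauchyKernel x))
      (-(2 : ℝ) ^ ((1 : ℝ) / 2 ^ n - 2) * brownianAverage^[n + 1] (cauchyKernelDeriv₂ x) t +
        (2 : ℝ) ^ ((1 : ℝ) / 2 ^ (n + 1) - 1) / Real.Gamma (1 - 1 / 2 ^ (n + 1)) / x ^ 2 *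
          t ^ (-((1 : ℝ) / 2 ^ (n + 1)))) t := by
  induction n generalizing t with
  | zero =>
    simp only [zero_add, Function.iterate_one, pow_zero, pow_one, div_one]
    refine Or.inl ⟨rfl, (hasDerivAt_brownianAverage_cauchyKernel hx ht).congr_deriv ?_⟩
    rw [heatKernel_zero_left ht, show (1 : ℝ) - 2 = -1 by norm_num, Real.rpow_neg_one,
      show (1 : ℝ) - 1 / 2 = 1 / 2 by norm_num, Real.Gamma_one_half_eq,
      show (1 / 2 - 1 : ℝ) = -(1 / 2) by norm_num, Real.rpow_neg two_pos.le, ← Real.sqrt_eq_rpow,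
      Real.sqrt_mul zero_le_two]
    have : √Real.pi ≠ 0 := by positivity
    field_simp
  | succ n ih =>
    set β : ℝ := 1 / 2 ^ (n + 1) with hβ
    have hβ0 : 0 < β := by positivity
    have hβ1 : β < 1 := by
      rw [hβ, div_lt_one (by positivity)]
      exact one_lt_pow₀ one_lt_two (by omega)
    have hγβ : (1 : ℝ) / 2 ^ n / 2 = β := by rw [hβ, pow_succ, div_div]
    have hβ2 : (1 : ℝ) / 2 ^ (n + 1 + 1) = β / 2 := by rw [hβ, pow_succ _ (n + 1), div_div]
    have h := (hasPowerDerivBound_iterate_cauchyKernel hx (n + 1)).hasCaputoDerivAt_brownianAverage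
      hβ0 hβ1.le (fun v hv => ih hv) ht
    rw [hγβ, brownianAverage_add_rpow
      (measurable_iterate_brownianAverage (measurable_cauchyKernelDeriv₂ x) _)
      (abs_iterate_brownianAverage_le
        (fun w => abs_cauchyKernelDeriv₂_le w (abs_pos.2 hx) le_rfl) _) _ _ (by linarith) ht] at h
    rw [Function.iterate_succ_apply' _ (n + 1), Function.iterate_succ_apply' _ (n + 1), hβ2]
    convert! h using 1
    rw [neg_div (2 : ℝ) (1 / 2 ^ n), hγβ]
    have hG := gaussianAbsMoment_neg β
    have hG1 := Real.Gamma_pos_of_pos (s := 1 - β / 2) (by linarith)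
    have hG2 := Real.Gamma_pos_of_pos (s := 1 - β) (by linarith)
    have h1 : (2 : ℝ) ^ (-β) * 2 ^ ((1 : ℝ) / 2 ^ n - 2) = 2 ^ (β - 2) := by
      rw [← Real.rpow_add two_pos, ← hγβ]; congr 1; ring
    have h2 : (2 : ℝ) ^ (-β) * 2 ^ (β - 1) = 1 / 2 := by
      rw [← Real.rpow_add two_pos, show -β + (β - 1) = -1 by ring, Real.rpow_neg_one, one_div]
    have h3 : (2 : ℝ) ^ (β / 2 - 1) = 2 ^ (β / 2) / 2 := Real.rpow_sub_one two_ne_zero _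
    -- The recursion for the coefficient of the power term: one more average multiplies it by
    -- `2^(-β)` and by the Gaussian moment of order `-β`.
    have h4 : (2 : ℝ) ^ (β / 2 - 1) / Real.Gamma (1 - β / 2) =
        2 ^ (-β) * (2 ^ (β - 1) / Real.Gamma (1 - β)) * gaussianAbsMoment (-β) := by
      rw [mul_div_assoc', h2, h3, div_eq_iff hG1.ne', mul_assoc, hG]
      field_simp
    rw [h4, ← h1]
    ring_nf

/-! ### Cauchy averages and integration against the density. -/

/-- The average of a function over a Cauchy variable of scale `s`. -/
noncomputable def cauchyAverage (φ : ℝ → ℝ) (s : ℝ) : ℝ := ∫ y, φ (s * y) ∂cauchyMeasure 0 1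

lemma integral_cauchyMeasure (φ : ℝ → ℝ) {s : ℝ≥0} (hs : s ≠ 0) :
    ∫ x, φ x ∂cauchyMeasure 0 s = Real.pi⁻¹ * ∫ x, φ x * cauchyKernel x s := by
  rw [cauchyMeasure_of_scale_ne_zero _ hs, integral_withDensity_eq_integral_toReal_smul
    (measurable_cauchyPDF _ _) (ae_of_all _ fun _ => ENNReal.ofReal_lt_top), ← integral_const_mul]
  congr 1 with x
  rw [cauchyPDF_def, ENNReal.toReal_ofReal (cauchyPDF_pos 0 hs x).le, cauchyPDFReal_def,
    cauchyKernel, smul_eq_mul, sub_zero, add_comm (x ^ 2)]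
  ring

lemma cauchyAverage_eq_integral_cauchyMeasure (φ : ℝ → ℝ) (s : ℝ≥0) :
    cauchyAverage φ s = ∫ x, φ x ∂cauchyMeasure 0 s := by
  rcases eq_or_ne s 0 with rfl | hs
  · simp [cauchyAverage]
  · have hs0 : (0 : ℝ) < s := NNReal.coe_pos.2 (pos_iff_ne_zero.2 hs)
    rw [integral_cauchyMeasure φ hs, cauchyAverage,
      integral_cauchyMeasure (fun y => φ (s * y)) one_ne_zero]
    have h := Measure.integral_comp_mul_left (fun x => φ x * cauchyKernel x s) (s : ℝ)
    rw [abs_of_pos (inv_pos.2 hs0), smul_eq_mul] at h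
    have h1 : ∫ y, φ (s * y) * cauchyKernel y (1 : ℝ≥0) =
        s * ∫ y, φ (s * y) * cauchyKernel (s * y) s := by
      rw [← integral_const_mul]
      congr 1 with y
      simp only [cauchyKernel, NNReal.coe_one]
      have : 0 < 1 + y ^ 2 := by positivity
      field_simp
    rw [h1, h, mul_inv_cancel_left₀ hs0.ne']

lemma cauchyAverage_eq (φ : ℝ → ℝ) {s : ℝ} (hs : 0 < s) :
    cauchyAverage φ s = Real.pi⁻¹ * ∫ x, φ x * cauchyKernel x s := by
  lift s to ℝ≥0 using hs.le
  rw [cauchyAverage_eq_integral_cauchyMeasure, integral_cauchyMeasure]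
  exact (NNReal.coe_pos.1 hs).ne'

@[fun_prop] lemma measurable_cauchyAverage {φ : ℝ → ℝ} (hφ : Measurable φ) :
    Measurable (cauchyAverage φ) := by
  have : StronglyMeasurable fun p : ℝ × ℝ => φ (p.1 * p.2) :=
    Measurable.stronglyMeasurable (by fun_prop)
  exact this.integral_prod_right.measurable

lemma abs_cauchyAverage_le {φ : ℝ → ℝ} {C : ℝ} (hC : ∀ w, |φ w| ≤ C) (s : ℝ) :
    |cauchyAverage φ s| ≤ C := by
  have := norm_integral_le_of_norm_le_const (μ := cauchyMeasure 0 1)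
    (f := fun y => φ (s * y)) (ae_of_all _ fun y => hC _)
  simpa [cauchyAverage] using this

lemma tendsto_cauchyAverage (φ : ℝ →ᵇ ℝ) : Tendsto (cauchyAverage φ) (𝓝[>] 0) (𝓝 (φ 0)) := by
  have key : Tendsto (cauchyAverage φ) (𝓝 0) (𝓝 (∫ _, φ 0 ∂cauchyMeasure 0 1)) := by
    refine tendsto_integral_filter_of_dominated_convergence (fun _ => ‖φ‖)
      (Eventually.of_forall fun t => ?_)
      (Eventually.of_forall fun t => ae_of_all _ fun y => φ.norm_coe_le_norm _)
      (integrable_const _) (ae_of_all _ fun y => ?_)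
    · exact (φ.continuous.comp (continuous_const_mul t)).aestronglyMeasurable
    · have : Continuous fun t : ℝ => φ (t * y) := φ.continuous.comp (continuous_mul_const y)
      simpa using this.tendsto 0
  simpa using key.mono_left nhdsWithin_le_nhds

lemma integrable_cauchyKernel {s : ℝ} (hs : 0 < s) :
    Integrable (fun x => cauchyKernel x s) ∧ ∫ x, cauchyKernel x s = Real.pi := by
  have h : Real.pi⁻¹ * ∫ x, cauchyKernel x s = 1 := by
    have := cauchyAverage_eq (fun _ => 1) hs
    simpa [cauchyAverage] using this.symm
  -- The integral is known to be nonzero from the total mass of the Cauchy law, and a nonzero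
  -- Bochner integral forces integrability.
  refine ⟨Integrable.of_integral_ne_zero fun h0 => ?_, ?_⟩
  · rw [h0] at h; simp at h
  · field_simp at h; exact h

lemma cauchyKernel_nonneg (x : ℝ) {s : ℝ} (hs : 0 ≤ s) : 0 ≤ cauchyKernel x s := by
  unfold cauchyKernel; positivity

lemma cauchyIteratedDensity_eq_integral (n : ℕ) (x t : ℝ) :
    cauchyIteratedDensity n x t = Real.pi⁻¹ * (2 ^ (n + 1) *
      ∫ s in Set.Ioi 0, cauchyKernel x s * iteratedHeatIntegral n s t) := by
  rw [cauchyIteratedDensity, ← integral_const_mul, ← integral_const_mul, ← integral_const_mul]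
  congr 1 with s
  rw [iteratedBrownianDensity, cauchyKernel]
  ring

lemma cauchyIteratedDensity_nonneg (n : ℕ) (x t : ℝ) : 0 ≤ cauchyIteratedDensity n x t := by
  rw [cauchyIteratedDensity_eq_integral]
  have : 0 ≤ ∫ s in Set.Ioi 0, cauchyKernel x s * iteratedHeatIntegral n s t :=
    setIntegral_nonneg measurableSet_Ioi fun s hs =>
      mul_nonneg (cauchyKernel_nonneg x (le_of_lt hs)) (iteratedHeatIntegral_nonneg n s t)
  positivity

lemma cauchyIteratedDensity_eq_iterate (n : ℕ) {x t : ℝ} (hx : x ≠ 0) (ht : 0 < t) :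
    cauchyIteratedDensity n x t = Real.pi⁻¹ * brownianAverage^[n + 1] (cauchyKernel x) t := by
  rw [cauchyIteratedDensity_eq_integral, integral_mul_iteratedHeatIntegral
    (measurable_cauchyKernel x) (fun s => abs_cauchyKernel_le s (abs_pos.2 hx) le_rfl) n ht]

lemma integrable_cauchyKernel_mul_prod {φ : ℝ → ℝ} (hφ : Measurable φ) {C : ℝ}
    (hC : ∀ w, |φ w| ≤ C) (n : ℕ) {t : ℝ} (ht : 0 < t) :
    Integrable (Function.uncurry fun x s => φ x * (cauchyKernel x s * iteratedHeatIntegral n s t))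
      (volume.prod (volume.restrict (Set.Ioi 0))) := by
  have hh := measurable_iteratedHeatIntegral n t
  have hm : Measurable (Function.uncurry fun x s => cauchyKernel x s * iteratedHeatIntegral n s t) := by
    simp only [Function.uncurry_def, cauchyKernel]
    fun_prop
  refine Integrable.bdd_mul (c := C) ?_ (hφ.comp measurable_fst).aestronglyMeasurable
    (ae_of_all _ fun p => hC _)
  refine (integrable_prod_iff' hm.aestronglyMeasurable).2 ⟨?_, ?_⟩
  · filter_upwards [ae_restrict_mem measurableSet_Ioi] with s hs
    have h1 := (integrable_cauchyKernel hs).1.mul_const (iteratedHeatIntegral n s t)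
    exact h1
  · refine ((integrableOn_iteratedHeatIntegral n ht).const_mul Real.pi).congr ?_
    filter_upwards [ae_restrict_mem measurableSet_Ioi] with s hs
    rw [← (integrable_cauchyKernel hs).2, ← integral_mul_const]
    congr 1 with x
    exact (Real.norm_of_nonneg (mul_nonneg (cauchyKernel_nonneg x (le_of_lt hs))
      (iteratedHeatIntegral_nonneg n s t))).symm

lemma integrable_cauchyIteratedDensity (n : ℕ) {t : ℝ} (ht : 0 < t) :
    Integrable fun x => cauchyIteratedDensity n x t := by
  have h := (integrable_cauchyKernel_mul_prod (φ := fun _ => 1) measurable_const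
    (fun _ => abs_one.le) n ht).integral_prod_left
  simp only [Function.uncurry_apply_pair, one_mul] at h
  simp only [cauchyIteratedDensity_eq_integral]
  exact (h.const_mul _).const_mul _

/-- Integrating against the density amounts to averaging over the Cauchy process and then over the
Brownian motions. -/
lemma integral_mul_cauchyIteratedDensity {φ : ℝ → ℝ} (hφ : Measurable φ) {C : ℝ}
    (hC : ∀ w, |φ w| ≤ C) (n : ℕ) {t : ℝ} (ht : 0 < t) :
    ∫ x, φ x * cauchyIteratedDensity n x t = brownianAverage^[n + 1] (cauchyAverage φ) t := by
  rw [← integral_mul_iteratedHeatIntegral (measurable_cauchyAverage hφ) (abs_cauchyAverage_le hC)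
    n ht]
  have h1 : ∀ x, φ x * cauchyIteratedDensity n x t = (2 ^ (n + 1) * Real.pi⁻¹) *
      ∫ s in Set.Ioi 0, φ x * (cauchyKernel x s * iteratedHeatIntegral n s t) := by
    intro x
    rw [cauchyIteratedDensity_eq_integral, integral_const_mul]
    ring
  simp only [h1]
  rw [integral_const_mul, integral_integral_swap (integrable_cauchyKernel_mul_prod hφ hC n ht),
    mul_assoc, ← integral_const_mul]
  congr 1
  refine setIntegral_congr_fun measurableSet_Ioi fun s hs => ?_
  simp only [cauchyAverage_eq φ hs, ← mul_assoc, integral_mul_const]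

/-! ### Processes at independent random times, and the law of the composition. -/

/-- The dyadic rational indexed by a level and a numerator. -/
noncomputable def dyadicTime (i : ℕ × ℕ) : ℝ≥0 := i.2 / 2 ^ i.1

/-- The value at time `s` of a right-continuous path, recovered from its values at dyadic times. -/
noncomputable def evalDyadic (path : ℕ × ℕ → ℝ) (s : ℝ≥0) : ℝ :=
  limsup (fun k : ℕ => path (k, ⌊s * 2 ^ k⌋₊ + 1)) atTop

/-- Joint measurability in path and time is what makes composition at a random time tractable. At
each level the time enters only through a measurable integer-valued index, and a `limsup` stays
measurable without any path regularity. -/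
lemma measurable_evalDyadic :
    Measurable fun p : (ℕ × ℕ → ℝ) × ℝ≥0 => evalDyadic p.1 p.2 := by
  refine Measurable.limsup fun k => ?_
  have h1 : Measurable fun q : (ℕ × ℕ → ℝ) × ℕ => q.1 (k, q.2 + 1) :=
    measurable_from_prod_countable_left fun j => measurable_pi_apply (k, j + 1)
  have h2 : Measurable fun p : (ℕ × ℕ → ℝ) × ℝ≥0 => (p.1, ⌊p.2 * 2 ^ k⌋₊) :=
    measurable_fst.prodMk (Nat.measurable_floor.comp (by fun_prop))
  exact h1.comp h2

@[fun_prop] lemma Measurable.evalDyadic {α : Type*} [MeasurableSpace α] {f : α → ℕ × ℕ → ℝ}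
    {g : α → ℝ≥0} (hf : Measurable f) (hg : Measurable g) :
    Measurable fun a => evalDyadic (f a) (g a) := by
  have h := measurable_evalDyadic.comp (hf.prodMk hg)
  exact h

/-- Adding `1` to the floor puts the grid point strictly to the right of `s`, at distance at most
`2^(-k)`, so right continuity suffices. -/
lemma tendsto_dyadicTime (s : ℝ≥0) :
    Tendsto (fun k : ℕ => dyadicTime (k, ⌊s * 2 ^ k⌋₊ + 1)) atTop (𝓝[>] s) := by
  have hlt : ∀ k : ℕ, s < dyadicTime (k, ⌊s * 2 ^ k⌋₊ + 1) := fun k => by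
    rw [dyadicTime, lt_div_iff₀ (by positivity)]
    push_cast
    exact Nat.lt_floor_add_one _
  have hle : ∀ k : ℕ, dyadicTime (k, ⌊s * 2 ^ k⌋₊ + 1) ≤ s + (1 / 2) ^ k := fun k => by
    rw [dyadicTime, div_le_iff₀ (by positivity), add_mul, ← mul_pow]
    push_cast
    have := Nat.floor_le (zero_le (a := s * 2 ^ k))
    rw [one_div, inv_mul_cancel₀ two_ne_zero, one_pow]
    gcongr
  refine tendsto_nhdsWithin_iff.2 ⟨?_, Eventually.of_forall hlt⟩
  have hlim : Tendsto (fun k : ℕ => s + (1 / 2 : ℝ≥0) ^ k) atTop (𝓝 (s + 0)) :=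
    tendsto_const_nhds.add (NNReal.tendsto_pow_atTop_nhds_zero_of_lt_one
      (by rw [one_div]; exact inv_lt_one_of_one_lt₀ one_lt_two))
  rw [add_zero] at hlim
  exact tendsto_of_tendsto_of_tendsto_of_le_of_le tendsto_const_nhds hlim (fun k => (hlt k).le) hle

lemma evalDyadic_eq {f : ℝ≥0 → ℝ} {s : ℝ≥0} (hf : Tendsto f (𝓝[>] s) (𝓝 (f s))) :
    evalDyadic (fun i => f (dyadicTime i)) s = f s :=
  (hf.comp (tendsto_dyadicTime s)).limsup_eq

section Motion

variable {Ω : Type*} [MeasurableSpace Ω] {P : Measure Ω}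

/-- A real process with measurable marginals and almost surely right-continuous paths. -/
structure IsRightContinuousMotion (X : ℝ≥0 → Ω → ℝ) (P : Measure Ω) : Prop where
  aemeasurable : ∀ s, AEMeasurable (X s) P
  rightCont : ∀ᵐ ω ∂P, ∀ s, Tendsto (X · ω) (𝓝[>] s) (𝓝 (X s ω))

lemma IsRightContinuousMotion.aemeasurable_dyadic {X : ℝ≥0 → Ω → ℝ}
    (hX : IsRightContinuousMotion X P) :
    AEMeasurable (fun ω (i : ℕ × ℕ) => X (dyadicTime i) ω) P :=
  aemeasurable_pi_iff.2 fun _ => hX.aemeasurable _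

lemma IsRightContinuousMotion.evalDyadic_ae_eq {X : ℝ≥0 → Ω → ℝ}
    (hX : IsRightContinuousMotion X P) :
    ∀ᵐ ω ∂P, ∀ s, evalDyadic (fun i => X (dyadicTime i) ω) s = X s ω := by
  filter_upwards [hX.rightCont] with ω hω s using evalDyadic_eq (hω s)

/-- A process evaluated at an independent random time is averaged over that time. -/
lemma IsRightContinuousMotion.integral_comp_time [IsProbabilityMeasure P] {X : ℝ≥0 → Ω → ℝ}
    (hX : IsRightContinuousMotion X P) {S : Ω → ℝ≥0} (hS : AEMeasurable S P)
    (hind : IndepFun (fun ω (i : ℕ × ℕ) => X (dyadicTime i) ω) S P) {φ : ℝ → ℝ}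
    (hφ : Measurable φ) {C : ℝ} (hC : ∀ w, |φ w| ≤ C) {f : ℝ≥0 → ℝ} (hf : Measurable f)
    (hfX : ∀ s, ∫ ω, φ (X s ω) ∂P = f s) :
    ∫ ω, φ (X (S ω) ω) ∂P = ∫ ω, f (S ω) ∂P := by
  set Y : Ω → ℕ × ℕ → ℝ := fun ω i => X (dyadicTime i) ω with hY
  have hYm : AEMeasurable Y P := hX.aemeasurable_dyadic
  -- Independence makes the joint law of path and time a product, so that Fubini can freeze the
  -- time.
  have hmap := (indepFun_iff_map_prod_eq_prod_map_map hYm hS).1 hind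
  have hm : Measurable fun p : (ℕ × ℕ → ℝ) × ℝ≥0 => φ (evalDyadic p.1 p.2) := by
    fun_prop
  have h1 : ∫ ω, φ (X (S ω) ω) ∂P = ∫ ω, φ (evalDyadic (Y ω) (S ω)) ∂P := by
    refine integral_congr_ae ?_
    filter_upwards [hX.evalDyadic_ae_eq] with ω hω
    rw [hω]
  have := Measure.isProbabilityMeasure_map hYm
  have := Measure.isProbabilityMeasure_map hS
  rw [h1, ← integral_map (φ := fun ω => (Y ω, S ω)) (hYm.prodMk hS)
    (f := fun p => φ (evalDyadic p.1 p.2)) hm.aestronglyMeasurable, hmap, integral_prod_symm,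
    ← integral_map hS hf.aestronglyMeasurable]
  · congr 1 with s
    have hms : Measurable fun y => φ (evalDyadic y s) := by fun_prop
    rw [integral_map hYm hms.aestronglyMeasurable, ← hfX s]
    refine integral_congr_ae ?_
    filter_upwards [hX.evalDyadic_ae_eq] with ω hω
    rw [hω]
  · exact Integrable.of_bound hm.aestronglyMeasurable C (ae_of_all _ fun p => hC _)

/-- The iterated motion as a function of the dyadic restrictions of the paths. -/
noncomputable def iteratedEval (t : ℝ≥0) : (n : ℕ) → (Fin (n + 1) → ℕ × ℕ → ℝ) → ℝ
  | 0, b => evalDyadic (b 0) t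
  | n + 1, b => evalDyadic (b 0) ‖iteratedEval t n (fun i => b i.succ)‖₊

lemma measurable_iteratedEval (t : ℝ≥0) (n : ℕ) : Measurable (iteratedEval t n) := by
  induction n with
  | zero => exact (measurable_pi_apply 0).evalDyadic measurable_const
  | succ n ih =>
    have h : Measurable fun (b : Fin (n + 2) → ℕ × ℕ → ℝ) (i : Fin (n + 1)) => b i.succ :=
      measurable_pi_lambda _ fun i => measurable_pi_apply i.succ
    exact (measurable_pi_apply 0).evalDyadic (ih.comp h).nnnorm

lemma iteratedMotion_ae_eq {n : ℕ} {Y : Fin (n + 1) → ℝ≥0 → Ω → ℝ}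
    (hY : ∀ i, IsRightContinuousMotion (Y i) P) (t : ℝ≥0) :
    ∀ᵐ ω ∂P, iteratedMotion n Y t ω = iteratedEval t n fun i j => Y i (dyadicTime j) ω := by
  induction n with
  | zero =>
    filter_upwards [(hY 0).evalDyadic_ae_eq] with ω hω
    exact (hω t).symm
  | succ n ih =>
    filter_upwards [(hY 0).evalDyadic_ae_eq, ih fun i => hY i.succ] with ω hω hi
    simp only [iteratedMotion, iteratedEval]
    rw [hω, hi]

lemma aemeasurable_iteratedMotion {n : ℕ} {Y : Fin (n + 1) → ℝ≥0 → Ω → ℝ}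
    (hY : ∀ i, IsRightContinuousMotion (Y i) P) (t : ℝ≥0) :
    AEMeasurable (iteratedMotion n Y t) P := by
  have h : AEMeasurable (fun ω => iteratedEval t n fun i j => Y i (dyadicTime j) ω) P :=
    (measurable_iteratedEval t n).comp_aemeasurable
      (aemeasurable_pi_iff.2 fun i => (hY i).aemeasurable_dyadic)
  exact h.congr ((iteratedMotion_ae_eq hY t).mono fun ω h => h.symm)

/-- Almost surely, the inner motion is a measurable functional of the dyadic values of the processes
other than the outermost one. -/
lemma indepFun_iteratedMotion [IsProbabilityMeasure P] {n : ℕ} {Y : Fin (n + 2) → ℝ≥0 → Ω → ℝ}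
    (hY : ∀ i, IsRightContinuousMotion (Y i) P)
    (hind : iIndepFun (fun i ω (j : ℕ × ℕ) => Y i (dyadicTime j) ω) P) (t : ℝ≥0) :
    IndepFun (fun ω (j : ℕ × ℕ) => Y 0 (dyadicTime j) ω)
      (fun ω => ‖iteratedMotion n (fun i => Y i.succ) t ω‖₊) P := by
  have h := hind.indepFun_finset₀ {0} {0}ᶜ disjoint_compl_right fun i => (hY i).aemeasurable_dyadic
  have hmem : ∀ i : Fin (n + 1), i.succ ∈ ({0}ᶜ : Finset (Fin (n + 2))) := fun i => by
    simp [Fin.succ_ne_zero]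
  have hsel : Measurable fun (b : ({0}ᶜ : Finset (Fin (n + 2))) → ℕ × ℕ → ℝ) (i : Fin (n + 1)) =>
      b ⟨i.succ, hmem i⟩ := measurable_pi_lambda _ fun i => measurable_pi_apply _
  have hφ : Measurable fun (b : ({0} : Finset (Fin (n + 2))) → ℕ × ℕ → ℝ) =>
      b ⟨0, Finset.mem_singleton_self 0⟩ := measurable_pi_apply _
  have hψ : Measurable fun (b : ({0}ᶜ : Finset (Fin (n + 2))) → ℕ × ℕ → ℝ) =>
      ‖iteratedEval t n fun i => b ⟨i.succ, hmem i⟩‖₊ :=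
    ((measurable_iteratedEval t n).comp hsel).nnnorm
  have h2 := h.comp hφ hψ
  refine h2.congr (ae_of_all _ fun ω => rfl) ?_
  filter_upwards [iteratedMotion_ae_eq (fun i => hY i.succ) t] with ω hω
  simp only [Function.comp_apply]
  rw [hω]

lemma integral_iteratedMotion_succ [IsProbabilityMeasure P] {n : ℕ}
    {Y : Fin (n + 2) → ℝ≥0 → Ω → ℝ} (hY : ∀ i, IsRightContinuousMotion (Y i) P)
    (hind : iIndepFun (fun i ω (j : ℕ × ℕ) => Y i (dyadicTime j) ω) P) (t : ℝ≥0) {φ : ℝ → ℝ}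
    (hφ : Measurable φ) {C : ℝ} (hC : ∀ w, |φ w| ≤ C) {f : ℝ → ℝ} (hf : Measurable f)
    (hfY : ∀ s : ℝ≥0, ∫ ω, φ (Y 0 s ω) ∂P = f s) :
    ∫ ω, φ (iteratedMotion (n + 1) Y t ω) ∂P =
      ∫ ω, f |iteratedMotion n (fun i => Y i.succ) t ω| ∂P := by
  have hS := (aemeasurable_iteratedMotion (fun i => hY i.succ) t).nnnorm
  exact (hY 0).integral_comp_time hS (indepFun_iteratedMotion hY hind t) hφ hC
    (f := fun s => f s) (hf.comp (by fun_prop)) hfY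

lemma ProbabilityTheory.IsBrownianReal.isRightContinuousMotion {B : ℝ≥0 → Ω → ℝ}
    (hB : IsBrownianReal B P) :
    IsRightContinuousMotion B P where
  aemeasurable := hB.aemeasurable
  rightCont := by
    filter_upwards [hB.cont] with ω hω s using (hω.tendsto s).mono_left nhdsWithin_le_nhds

lemma ProbabilityTheory.IsBrownianReal.integral_comp_abs {B : ℝ≥0 → Ω → ℝ}
    (hB : IsBrownianReal B P) {f : ℝ → ℝ}
    (hf : Measurable f) (s : ℝ≥0) : ∫ ω, f |B s ω| ∂P = brownianAverage f s := by
  have hm : Measurable fun y => f |y| := hf.comp (by fun_prop)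
  rw [brownianAverage_eq_integral_gaussianReal hf, ← (hB.hasLaw_eval s).map_eq,
    integral_map (hB.aemeasurable s) hm.aestronglyMeasurable]

lemma IsCauchyMotion.hasLaw_eval {X : ℝ≥0 → Ω → ℝ} (hX : IsCauchyMotion X P) (s : ℝ≥0) :
    HasLaw (X s) (cauchyMeasure 0 s) P := by
  have h := hX.hasLaw_sub 0 s (zero_le)
  rw [tsub_zero] at h
  refine h.congr ?_
  filter_upwards [hX.eval_zero] with ω hω
  simp [hω]

lemma IsCauchyMotion.isRightContinuousMotion {X : ℝ≥0 → Ω → ℝ} (hX : IsCauchyMotion X P) :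
    IsRightContinuousMotion X P where
  aemeasurable s := (hX.hasLaw_eval s).aemeasurable
  rightCont := by filter_upwards [hX.cadlag] with ω hω s using (hω s).1

lemma IsCauchyMotion.integral_comp {X : ℝ≥0 → Ω → ℝ} (hX : IsCauchyMotion X P) {φ : ℝ → ℝ}
    (hφ : Measurable φ) (s : ℝ≥0) : ∫ ω, φ (X s ω) ∂P = cauchyAverage φ s := by
  rw [cauchyAverage_eq_integral_cauchyMeasure, ← (hX.hasLaw_eval s).map_eq,
    integral_map (hX.hasLaw_eval s).aemeasurable hφ.aestronglyMeasurable]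

/-- The law of the modulus of the iterated Brownian motion. -/
lemma integral_comp_abs_iteratedMotion [IsProbabilityMeasure P] {n : ℕ}
    {B : Fin (n + 1) → ℝ≥0 → Ω → ℝ} (hB : ∀ i, IsBrownianReal (B i) P)
    (hind : iIndepFun (fun i ω (j : ℕ × ℕ) => B i (dyadicTime j) ω) P) (t : ℝ≥0) {f : ℝ → ℝ}
    (hf : Measurable f) {C : ℝ} (hC : ∀ w, |f w| ≤ C) :
    ∫ ω, f |iteratedMotion n B t ω| ∂P = brownianAverage^[n + 1] f t := by
  induction n generalizing f with
  | zero => exact (hB 0).integral_comp_abs hf t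
  | succ n ih =>
    rw [integral_iteratedMotion_succ (fun i => (hB i).isRightContinuousMotion) hind t
      (φ := fun y => f |y|) (hf.comp (by fun_prop)) (fun w => hC _) (measurable_brownianAverage hf)
      (fun s => (hB 0).integral_comp_abs hf s),
      ih (fun i => hB i.succ) (hind.precomp (Fin.succ_injective _)) (measurable_brownianAverage hf)
        (abs_brownianAverage_le hC), ← Function.iterate_succ_apply]

/-- A Cauchy process at an independent iterated Brownian time. -/
lemma hasLaw_cauchy_iteratedMotion [IsProbabilityMeasure P] {n : ℕ} {X : ℝ≥0 → Ω → ℝ}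
    {B : Fin (n + 1) → ℝ≥0 → Ω → ℝ} (hX : IsCauchyMotion X P)
    (hB : ∀ i, IsBrownianReal (B i) P)
    (hind : iIndepFun (fun (i : Fin (n + 2)) (ω : Ω) (t : ℝ≥0) =>
        (Fin.cons X B : Fin (n + 2) → ℝ≥0 → Ω → ℝ) i t ω) P) {t : ℝ≥0} (ht : 0 < t) :
    HasLaw (fun ω => X ‖iteratedMotion n B t ω‖₊ ω)
      (volume.withDensity fun x => ENNReal.ofReal (cauchyIteratedDensity n x t)) P := by
  set Y : Fin (n + 2) → ℝ≥0 → Ω → ℝ := Fin.cons X B with hYdef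
  have hY : ∀ i, IsRightContinuousMotion (Y i) P :=
    Fin.cases hX.isRightContinuousMotion fun i => (hB i).isRightContinuousMotion
  have hd : iIndepFun (fun i ω (j : ℕ × ℕ) => Y i (dyadicTime j) ω) P :=
    hind.comp (fun _ path j => path (dyadicTime j))
      fun _ => measurable_pi_lambda _ fun j => measurable_pi_apply _
  have hae : AEMeasurable (iteratedMotion (n + 1) Y t) P := aemeasurable_iteratedMotion hY t
  -- With the Cauchy process put in front of the Brownian motions, the composition is definitionally
  -- one more level of the same iteration.
  change HasLaw (iteratedMotion (n + 1) Y t) _ P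
  refine ⟨hae, Measure.ext fun A hA => ?_⟩
  have hφ : Measurable (A.indicator fun _ => (1 : ℝ)) := measurable_const.indicator hA
  have hC : ∀ w, |A.indicator (fun _ => (1 : ℝ)) w| ≤ 1 := fun w => by
    by_cases hw : w ∈ A <;> simp [hw]
  have h1 := integral_iteratedMotion_succ hY hd t hφ hC (measurable_cauchyAverage hφ)
    (fun s => hX.integral_comp hφ s)
  have h2 := integral_comp_abs_iteratedMotion hB (hd.precomp (Fin.succ_injective _)) t
    (measurable_cauchyAverage hφ) (abs_cauchyAverage_le hC)
  have h3 := integral_mul_cauchyIteratedDensity hφ hC n (NNReal.coe_pos.2 ht)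
  have h4 : ∫ ω, A.indicator (fun _ => (1 : ℝ)) (iteratedMotion (n + 1) Y t ω) ∂P =
      ∫ x in A, cauchyIteratedDensity n x t := by
    rw [h1, ← integral_indicator hA]
    refine (h2.trans h3.symm).trans ?_
    congr 1 with x
    by_cases hx : x ∈ A <;> simp [hx]
  have := Measure.isProbabilityMeasure_map hae
  rw [← integral_map hae hφ.aestronglyMeasurable, integral_indicator_const _ hA, smul_eq_mul,
    mul_one] at h4
  rw [withDensity_apply _ hA, ← ofReal_integral_eq_lintegral_ofReal
    (integrable_cauchyIteratedDensity n (NNReal.coe_pos.2 ht)).integrableOn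
    (ae_of_all _ fun x => cauchyIteratedDensity_nonneg n x t), ← h4, ofReal_measureReal]

end Motion

/-! ### Initial condition, smoothness in space and final constants. -/

lemma hasDiracInitialValue_cauchyIteratedDensity (n : ℕ) :
    HasDiracInitialValue (cauchyIteratedDensity n) := by
  refine ⟨fun t ht => integrable_cauchyIteratedDensity n ht, fun φ => ?_⟩
  have hφ : Measurable φ := φ.continuous.measurable
  have hC : ∀ w, |φ w| ≤ ‖φ‖ := φ.norm_coe_le_norm
  refine (tendsto_iterate_brownianAverage (measurable_cauchyAverage hφ) (abs_cauchyAverage_le hC)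
    (tendsto_cauchyAverage φ) (n + 1)).congr' ?_
  filter_upwards [self_mem_nhdsWithin] with t ht
  exact (integral_mul_cauchyIteratedDensity hφ hC n ht).symm

/-- For `x ≠ 0` the kernel tends to `0` as `s ↓ 0`, and the averages inherit this limit. -/
lemma tendsto_cauchyIteratedDensity_zero (n : ℕ) {x : ℝ} (hx : x ≠ 0) :
    Tendsto (fun t => cauchyIteratedDensity n x t) (𝓝[>] 0) (𝓝 0) := by
  have h0 : Tendsto (cauchyKernel x) (𝓝[>] 0) (𝓝 0) := by
    have := (hasDerivAt_cauchyKernel_right hx 0).continuousAt.tendsto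
    simpa [cauchyKernel] using this.mono_left (nhdsWithin_le_nhds (s := Set.Ioi 0))
  have h1 := (tendsto_iterate_brownianAverage (measurable_cauchyKernel x)
    (fun s => abs_cauchyKernel_le s (abs_pos.2 hx) le_rfl) h0 (n + 1)).const_mul Real.pi⁻¹
  rw [mul_zero] at h1
  refine h1.congr' ?_
  filter_upwards [self_mem_nhdsWithin] with t ht
  exact (cauchyIteratedDensity_eq_iterate n hx ht).symm

lemma contDiffAt_cauchyIteratedDensity (n : ℕ) {x t : ℝ} (hx : x ≠ 0) (ht : 0 < t) :
    ContDiffAt ℝ 2 (fun y => cauchyIteratedDensity n y t) x ∧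
      iteratedDeriv 2 (fun y => cauchyIteratedDensity n y t) x =
        Real.pi⁻¹ * brownianAverage^[n + 1] (cauchyKernelDeriv₂ x) t := by
  obtain ⟨h1, h2⟩ := contDiffAt_integral_cauchyKernel hx (integrableOn_iteratedHeatIntegral n ht)
  have heq : (fun y => cauchyIteratedDensity n y t) = fun y => (Real.pi⁻¹ * 2 ^ (n + 1)) *
      ∫ s in Set.Ioi 0, cauchyKernel y s * iteratedHeatIntegral n s t := by
    ext y
    rw [cauchyIteratedDensity_eq_integral, mul_assoc]
  rw [heq]
  refine ⟨contDiffAt_const.mul h1, ?_⟩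
  rw [← integral_mul_iteratedHeatIntegral (measurable_cauchyKernelDeriv₂ x)
    (fun s => abs_cauchyKernelDeriv₂_le s (abs_pos.2 hx) le_rfl) n ht, iteratedDeriv_const_mul_field,
    h2, mul_assoc]

/-- With `β = 2^(-(n+1))`, this rests on `Γ(1 - β) = -β Γ(-β)` and `Γ(-1/2) = -2 √π`; the factor
`2^n` in the stated constant absorbs `β`. -/
lemma caputo_constant_eq (n : ℕ) :
    (2 : ℝ) ^ ((n : ℝ) - 1 + 1 / 2 ^ (n + 1)) / Real.pi ^ ((3 : ℝ) / 2) *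
        (Real.Gamma (-1 / 2) / Real.Gamma (-1 / 2 ^ (n + 1))) =
      Real.pi⁻¹ * ((2 : ℝ) ^ ((1 : ℝ) / 2 ^ (n + 1) - 1) / Real.Gamma (1 - 1 / 2 ^ (n + 1))) := by
  set β : ℝ := 1 / 2 ^ (n + 1) with hβ
  have hβ0 : 0 < β := by positivity
  have hβ1 : β < 1 := by
    rw [hβ, div_lt_one (by positivity)]
    exact one_lt_pow₀ one_lt_two (by omega)
  have h1 : Real.Gamma (1 - β) = -β * Real.Gamma (-β) := by
    rw [← Real.Gamma_add_one (by linarith), neg_add_eq_sub]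
  have h2 : √Real.pi = -(1 / 2) * Real.Gamma (-1 / 2) := by
    rw [← Real.Gamma_one_half_eq, ← neg_div, ← Real.Gamma_add_one (by norm_num)]
    norm_num
  have hG := Real.Gamma_pos_of_pos (s := 1 - β) (by linarith)
  have hG0 : Real.Gamma (-β) ≠ 0 := by
    intro h
    rw [h, mul_zero] at h1
    exact hG.ne' h1
  have h3 : (2 : ℝ) ^ ((n : ℝ) - 1 + β) * 2 * β = 2 ^ (β - 1) := by
    have : β = 2 ^ (-((n : ℝ) + 1)) := by
      rw [Real.rpow_neg two_pos.le, hβ, one_div]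
      norm_cast
    nth_rw 2 [this]
    nth_rw 2 [← Real.rpow_one 2]
    rw [← Real.rpow_add two_pos, ← Real.rpow_add two_pos]
    congr 1
    ring
  have h4 : Real.pi ^ ((3 : ℝ) / 2) = Real.pi * √Real.pi := by
    rw [show (3 : ℝ) / 2 = 1 + 1 / 2 by norm_num, Real.rpow_add Real.pi_pos, Real.rpow_one,
      ← Real.sqrt_eq_rpow]
  have h5 : Real.Gamma (-1 / 2) = -2 * √Real.pi := by linarith
  have hpi : √Real.pi ≠ 0 := by positivity
  rw [h4, h5, neg_div ((2 : ℝ) ^ (n + 1)) 1, ← hβ, h1, ← h3]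
  field_simp

theorem theorem3p4 (n : ℕ) :
    -- the law of `C(|I_n(t)|)` has the stated density
    (∀ (Ω : Type*) [MeasurableSpace Ω] (P : Measure Ω) [IsProbabilityMeasure P]
      (C : ℝ≥0 → Ω → ℝ) (B : Fin (n + 1) → ℝ≥0 → Ω → ℝ),
      IsCauchyMotion C P → (∀ i, IsBrownianReal (B i) P) →
      iIndepFun (fun (i : Fin (n + 2)) (ω : Ω) (t : ℝ≥0) =>
        (Fin.cons C B : Fin (n + 2) → ℝ≥0 → Ω → ℝ) i t ω) P →
      ∀ t : ℝ≥0, 0 < t →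
        HasLaw (fun ω => C ‖iteratedMotion n B t ω‖₊ ω)
          (volume.withDensity fun x => ENNReal.ofReal (cauchyIteratedDensity n x t)) P) ∧
    -- the fractional equation
    (∀ x t : ℝ, x ≠ 0 → 0 < t →
      ContDiffAt ℝ 2 (fun y => cauchyIteratedDensity n y t) x ∧
      HasCaputoDerivAt (1 / 2 ^ n) (fun s => cauchyIteratedDensity n x s)
        (-(2 : ℝ) ^ ((1 : ℝ) / 2 ^ n - 2) *
            iteratedDeriv 2 (fun y => cauchyIteratedDensity n y t) x +
          (2 : ℝ) ^ ((n : ℝ) - 1 + 1 / 2 ^ (n + 1)) / Real.pi ^ ((3 : ℝ) / 2) *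
            (Real.Gamma (-1 / 2) / Real.Gamma (-1 / 2 ^ (n + 1))) *
            (t ^ (-(1 : ℝ) / 2 ^ (n + 1)) / x ^ 2)) t) ∧
    -- the initial condition, weakly on the line and pointwise off the origin
    HasDiracInitialValue (cauchyIteratedDensity n) ∧
    (∀ x : ℝ, x ≠ 0 → Tendsto (fun t => cauchyIteratedDensity n x t) (𝓝[>] 0) (𝓝 0)) := by
  refine ⟨fun Ω _ P _ C B hC hB hind t ht => hasLaw_cauchy_iteratedMotion hC hB hind ht,
    fun x t hx ht => ?_, hasDiracInitialValue_cauchyIteratedDensity n,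
    fun x hx => tendsto_cauchyIteratedDensity_zero n hx⟩
  obtain ⟨h1, h2⟩ := contDiffAt_cauchyIteratedDensity n hx ht
  refine ⟨h1, ?_⟩
  rw [h2, caputo_constant_eq, neg_div (2 ^ (n + 1)) (1 : ℝ)]
  have h := (hasCaputoDerivAt_iterate_cauchyKernel hx n ht).const_mul Real.pi⁻¹
  have h3 := h.congr_of_eqOn_Ioi (fun s hs => cauchyIteratedDensity_eq_iterate n hx hs) ht
  convert! h3 using 1
  ring
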